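/- Let $F$ be Thompson's group: the group, under composition, of orientation-preserving piecewise linear homeomorphisms of $[0,1]$ whose breakpoints are dyadic rationals and whose slopes are integer powers of $2$. For $g\in F$ let $\operatorname{supp}(g)$ be the closure of $\{t : g(t)\ne t\}$. Let $x_0\in F$ be the homeomorphism that is linear between the points $(0,0),(\tfrac12,\tfrac14),(\tfrac34,\tfrac12),(1,1)$ of its graph, and $x_1\in F$ the one that is linear between $(0,0),(\tfrac12,\tfrac12),(\tfrac34,\tfrac58),(\tfrac78,\tfrac34),(1,1)$. For a group $G$ with finite generating set $S$, $\operatorname{girth}(G,S)$ is the length of a shortest nontrivial freely reduced word in $S^{\pm1}$ that represents the identity of $G$ ($\infty$ if there is none), and the girth of $G$ is the supremum of $\operatorname{girth}(G,S)$ over all finite generating sets $S$ of $G$. **Theorem.** Thompson's group $F$ has infinite girth. Moreover, let $l\ge 3$ be an integer and let $(\varepsilon_m)_{m\ge 0}$ be any sequence of positive reals with $2^{m^2}\varepsilon_m<\tfrac12$ for every $m$. Then there are elements $u_{1,m},\dots,u_{l-2,m}\in F$ ($m\ge0$) such that, with $$S_{l,m}=\{x_0,\; x_0^m u_{1,m}^m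 x_1,\; u_{1,m},\dots,u_{l-2,m}\},$$ the following hold: 1. for every $m$, the set $S_{l,m}$ has exactly $l$ elements and generates $F$; 2. for every $m$ and $1\le i\le l-2$, $\operatorname{supp}(u_{i,m})\subseteq[0,\varepsilon_m)$; 3. for every $m$ and every nontrivial freely reduced word $w$ of length at most $2m^2$ in the free group on $a,b_1,\dots,b_{l-2}$, the homeomorphism $w(x_0,u_{1,m},\dots,u_{l-2,m})$ moves some point of $(0,\varepsilon_m)$; 4. $\operatorname{girth}(F,S_{l,m})\to\infty$ as $m\to\infty$. -/

import Mathlib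

open Filter Topology

/-! ### Girth -/

open Classical in
/-- The girth of a group `G` with respect to a subset `S`: the length of a shortest relator, i.e. of a
shortest nontrivial freely reduced word in the letters `S ∪ S⁻¹` that evaluates to `1` in `G`
(and `⊤` if there is no such word). `FreeGroup.norm` is the length of the reduced word. -/
noncomputable def girth {G : Type*} [Group G] (S : Set G) : ℕ∞ :=
  ⨅ (w : FreeGroup S) (_ : w ≠ 1) (_ : FreeGroup.lift (Subtype.val : S → G) w = 1),
    (w.norm : ℕ∞)

/-- The girth of a group: the supremum of `girth S` over all finite generating sets `S`. -/
noncomputable def groupGirth (G : Type*) [Group G] : ℕ∞ :=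
  ⨆ (S : Finset G) (_ : Subgroup.closure (S : Set G) = ⊤), girth (S : Set G)

/-! ### Thompson's group `F` -/

/-- Dyadic rational numbers, as real numbers. -/
def IsDyadic (x : ℝ) : Prop := ∃ (a : ℤ) (n : ℕ), x = a / 2 ^ n

/-- `f` is piecewise linear, its breakpoints lie in a finite set `B` of dyadic rationals, and the
slopes of its linear pieces are powers of `2`: on every interval `[a, b]` without a point of `B` in
its interior, `f` is affine with slope `2 ^ k` for an integer `k`. -/
def IsDyadicPL (f : unitInterval → unitInterval) : Prop :=
  ∃ B : Finset unitInterval, (∀ b ∈ B, IsDyadic b) ∧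
    ∀ a b : unitInterval, a < b → (∀ t ∈ B, ¬ (a < t ∧ t < b)) →
      ∃ k : ℤ, ∀ s ∈ Set.Icc a b, ∀ t ∈ Set.Icc a b,
        (f t : ℝ) - f s = (2 : ℝ) ^ k * ((t : ℝ) - s)

theorem IsDyadic.add {x y : ℝ} (hx : IsDyadic x) (hy : IsDyadic y) : IsDyadic (x + y) := by
  obtain ⟨a, n, rfl⟩ := hx
  obtain ⟨b, m, rfl⟩ := hy
  refine ⟨a * 2 ^ m + b * 2 ^ n, n + m, ?_⟩
  push_cast
  rw [pow_add]
  field_simp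

theorem IsDyadic.neg {x : ℝ} (hx : IsDyadic x) : IsDyadic (-x) := by
  obtain ⟨a, n, rfl⟩ := hx
  exact ⟨-a, n, by push_cast; ring⟩

theorem IsDyadic.sub {x y : ℝ} (hx : IsDyadic x) (hy : IsDyadic y) : IsDyadic (x - y) := by
  rw [sub_eq_add_neg]
  exact hx.add hy.neg

theorem IsDyadic.zpow_mul {x : ℝ} (hx : IsDyadic x) (k : ℤ) : IsDyadic ((2 : ℝ) ^ k * x) := by
  obtain ⟨a, n, rfl⟩ := hx
  obtain ⟨k, rfl | rfl⟩ := k.eq_nat_or_neg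
  · exact ⟨2 ^ k * a, n, by push_cast; rw [zpow_natCast]; ring⟩
  · refine ⟨a, n + k, ?_⟩
    rw [zpow_neg, zpow_natCast, pow_add]
    field_simp

theorem StrictMono.map_zero_unitInterval {f : unitInterval ≃ₜ unitInterval} (hf : StrictMono f) :
    f 0 = 0 := by
  refine le_antisymm ?_ unitInterval.nonneg'
  have h : f 0 ≤ f (f.symm 0) := hf.monotone unitInterval.nonneg'
  simpa using h

theorem StrictMono.symm_unitInterval {f : unitInterval ≃ₜ unitInterval} (hf : StrictMono f) :
    StrictMono f.symm := by
  intro a b hab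
  rw [← hf.lt_iff_lt]
  simpa using hab

theorem IsDyadicPL.map_dyadic {f : unitInterval ≃ₜ unitInterval} (hf : StrictMono f)
    (hp : IsDyadicPL f) (t : unitInterval) (ht : IsDyadic t) : IsDyadic (f t) := by
  classical
  obtain ⟨B, hB, h⟩ := hp
  generalize hn : (B.filter (· < t)).card = n
  induction n using Nat.strong_induction_on generalizing t with
  | _ n ih =>
    -- the affine piece from `b` to `t` transports the property from `f b` to `f t`
    have step : ∀ b : unitInterval, b < t → IsDyadic b → IsDyadic (f b) →
        (∀ s ∈ B, ¬ (b < s ∧ s < t)) → IsDyadic (f t) := by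
      intro b hbt hb hfb hs
      obtain ⟨k, hk⟩ := h b t hbt hs
      have e := hk b ⟨le_rfl, hbt.le⟩ t ⟨hbt.le, le_rfl⟩
      have e' : (f t : ℝ) = (2 : ℝ) ^ k * ((t : ℝ) - b) + f b := by linarith
      rw [e']
      exact ((ht.sub hb).zpow_mul k).add hfb
    have h0 : IsDyadic ((0 : unitInterval) : ℝ) := ⟨0, 0, by simp⟩
    by_cases hne : (B.filter (· < t)).Nonempty
    · set b := (B.filter (· < t)).max' hne with hbdef
      have hbm : b ∈ B.filter (· < t) := Finset.max'_mem _ _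
      have hb := Finset.mem_filter.1 hbm
      refine step b hb.2 (hB b hb.1) (ih _ ?_ b (hB b hb.1) rfl) ?_
      · rw [← hn]
        refine Finset.card_lt_card (Finset.ssubset_iff_of_subset ?_ |>.2 ⟨b, hbm, by simp⟩)
        intro s hs
        rw [Finset.mem_filter] at hs ⊢
        exact ⟨hs.1, hs.2.trans hb.2⟩
      · rintro s hs ⟨h1, h2⟩
        exact absurd (Finset.le_max' _ s (Finset.mem_filter.2 ⟨hs, h2⟩)) (not_le.2 h1)
    · rcases (unitInterval.nonneg' : (0 : unitInterval) ≤ t).eq_or_lt with h1 | h1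
      · rw [← h1, hf.map_zero_unitInterval]
        exact h0
      · refine step 0 h1 h0 (by rw [hf.map_zero_unitInterval]; exact h0) ?_
        rintro s hs ⟨-, h2⟩
        exact hne ⟨s, Finset.mem_filter.2 ⟨hs, h2⟩⟩

theorem IsDyadicPL.symm_dyadic {f : unitInterval ≃ₜ unitInterval} (hf : StrictMono f)
    (hp : IsDyadicPL f) : IsDyadicPL f.symm := by
  classical
  have hp' := hp
  obtain ⟨B, hB, h⟩ := hp
  refine ⟨B.image f, ?_, ?_⟩
  · intro b hb
    obtain ⟨c, hc, rfl⟩ := Finset.mem_image.1 hb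
    exact hp'.map_dyadic hf c (hB c hc)
  · intro a b hab hs
    have hm := hf.symm_unitInterval
    obtain ⟨k, hk⟩ := h (f.symm a) (f.symm b) (hm hab) (by
      rintro t ht ⟨h1, h2⟩
      refine hs (f t) (Finset.mem_image_of_mem _ ht) ⟨?_, ?_⟩
      · simpa using hf h1
      · simpa using hf h2)
    refine ⟨-k, fun s hs t ht => ?_⟩
    have e := hk (f.symm s) ⟨hm.monotone hs.1, hm.monotone hs.2⟩
      (f.symm t) ⟨hm.monotone ht.1, hm.monotone ht.2⟩
    simp only [Homeomorph.apply_symm_apply] at e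
    rw [e, zpow_neg, inv_mul_cancel_left₀ (by positivity)]

theorem IsDyadicPL.comp_dyadic {f g : unitInterval ≃ₜ unitInterval} (hg : StrictMono g)
    (hpf : IsDyadicPL f) (hpg : IsDyadicPL g) : IsDyadicPL (f * g : unitInterval ≃ₜ unitInterval) := by
  classical
  have hpi := hpg.symm_dyadic hg
  obtain ⟨B, hB, h⟩ := hpf
  obtain ⟨C, hC, h'⟩ := hpg
  refine ⟨C ∪ B.image g.symm, ?_, ?_⟩
  · intro b hb
    rcases Finset.mem_union.1 hb with hb | hb
    · exact hC b hb
    · obtain ⟨c, hc, rfl⟩ := Finset.mem_image.1 hb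
      exact hpi.map_dyadic hg.symm_unitInterval c (hB c hc)
  · intro a b hab hs
    obtain ⟨k, hk⟩ := h' a b hab fun t ht => hs t (Finset.mem_union_left _ ht)
    obtain ⟨j, hj⟩ := h (g a) (g b) (hg hab) (by
      rintro t ht ⟨h1, h2⟩
      refine hs (g.symm t) (Finset.mem_union_right _ (Finset.mem_image_of_mem _ ht)) ⟨?_, ?_⟩
      · rw [← hg.lt_iff_lt]
        simpa using h1
      · rw [← hg.lt_iff_lt]
        simpa using h2)
    refine ⟨j + k, fun s hs t ht => ?_⟩
    have e := hj (g s) ⟨hg.monotone hs.1, hg.monotone hs.2⟩ (g t)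
      ⟨hg.monotone ht.1, hg.monotone ht.2⟩
    rw [hk s hs t ht, ← mul_assoc, ← zpow_add₀ two_ne_zero] at e
    exact e

/-- Thompson's group `F`: the orientation-preserving piecewise linear homeomorphisms of `[0, 1]`
with dyadic breakpoints and slopes powers of `2`; the product is composition,
`(f * g) t = f (g t)`. -/
def thompsonF : Subgroup (unitInterval ≃ₜ unitInterval) where
  carrier := {f | StrictMono f ∧ IsDyadicPL f}
  mul_mem' := fun ⟨hf, hf'⟩ ⟨hg, hg'⟩ => ⟨hf.comp hg, hf'.comp_dyadic hg hg'⟩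
  one_mem' := ⟨strictMono_id, ∅, by simp, fun _ _ _ _ => ⟨0, fun _ _ _ _ => by simp⟩⟩
  inv_mem' := fun ⟨hf, hf'⟩ => ⟨hf.symm_unitInterval, hf'.symm_dyadic hf⟩

/-- The support of an element of `F`: the closure of the set of points that it moves. -/
def supportF (g : thompsonF) : Set unitInterval := closure {t | g.1 t ≠ t}

/-! ### The standard generators `x₀` and `x₁` -/

/-- The graph of `x₀`, through `(0, 0)`, `(1/2, 1/4)`, `(3/4, 1/2)`, `(1, 1)`. -/
noncomputable def x0Fun (t : ℝ) : ℝ :=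
  if t ≤ 1 / 2 then t / 2 else if t ≤ 3 / 4 then t - 1 / 4 else 2 * t - 1

/-- The inverse of `x0Fun`. -/
noncomputable def x0Inv (t : ℝ) : ℝ :=
  if t ≤ 1 / 4 then 2 * t else if t ≤ 1 / 2 then t + 1 / 4 else (t + 1) / 2

/-- The graph of `x₁`, through `(0, 0)`, `(1/2, 1/2)`, `(3/4, 5/8)`, `(7/8, 3/4)`, `(1, 1)`. -/
noncomputable def x1Fun (t : ℝ) : ℝ :=
  if t ≤ 1 / 2 then t else if t ≤ 3 / 4 then t / 2 + 1 / 4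
    else if t ≤ 7 / 8 then t - 1 / 8 else 2 * t - 1

/-- The inverse of `x1Fun`. -/
noncomputable def x1Inv (t : ℝ) : ℝ :=
  if t ≤ 1 / 2 then t else if t ≤ 5 / 8 then 2 * t - 1 / 2
    else if t ≤ 3 / 4 then t + 1 / 8 else (t + 1) / 2

/-- The homeomorphism of `[0, 1]` given by two mutually inverse monotone maps. -/
def homeoOfMonotone (f g : ℝ → ℝ) (hf : ∀ t ∈ Set.Icc (0 : ℝ) 1, f t ∈ Set.Icc (0 : ℝ) 1)
    (hg : ∀ t ∈ Set.Icc (0 : ℝ) 1, g t ∈ Set.Icc (0 : ℝ) 1) (hgf : ∀ t, g (f t) = t)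
    (hfg : ∀ t, f (g t) = t) (hfm : Monotone f) (hgm : Monotone g) :
    unitInterval ≃ₜ unitInterval :=
  OrderIso.toHomeomorph
    { toFun := fun t => ⟨f t, hf t t.2⟩
      invFun := fun t => ⟨g t, hg t t.2⟩
      left_inv := fun t => Subtype.ext (hgf t)
      right_inv := fun t => Subtype.ext (hfg t)
      map_rel_iff' := fun {a b} =>
        ⟨fun h => Subtype.coe_le_coe.1 (hgf a ▸ hgf b ▸ hgm h), fun h => hfm h⟩ }

theorem strictMono_homeoOfMonotone (f g : ℝ → ℝ) (hf hg hgf hfg hfm hgm) :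
    StrictMono (homeoOfMonotone f g hf hg hgf hfg hfm hgm) :=
  Monotone.strictMono_of_injective (fun _ _ h => hfm h) (Homeomorph.injective _)

/-- `x₀` as a homeomorphism of `[0, 1]`. -/
noncomputable def x0Homeo : unitInterval ≃ₜ unitInterval :=
  homeoOfMonotone x0Fun x0Inv
    (by rintro t ⟨h0, h1⟩; unfold x0Fun; split_ifs <;> constructor <;> linarith)
    (by rintro t ⟨h0, h1⟩; unfold x0Inv; split_ifs <;> constructor <;> linarith)
    (by intro t; unfold x0Fun x0Inv; split_ifs <;> linarith)
    (by intro t; unfold x0Fun x0Inv; split_ifs <;> linarith)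
    (by intro s t h; unfold x0Fun; split_ifs <;> linarith)
    (by intro s t h; unfold x0Inv; split_ifs <;> linarith)

/-- `x₁` as a homeomorphism of `[0, 1]`. -/
noncomputable def x1Homeo : unitInterval ≃ₜ unitInterval :=
  homeoOfMonotone x1Fun x1Inv
    (by rintro t ⟨h0, h1⟩; unfold x1Fun; split_ifs <;> constructor <;> linarith)
    (by rintro t ⟨h0, h1⟩; unfold x1Inv; split_ifs <;> constructor <;> linarith)
    (by intro t; unfold x1Fun x1Inv; split_ifs <;> linarith)
    (by intro t; unfold x1Fun x1Inv; split_ifs <;> linarith)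
    (by intro s t h; unfold x1Fun; split_ifs <;> linarith)
    (by intro s t h; unfold x1Inv; split_ifs <;> linarith)

theorem x0Homeo_mem : x0Homeo ∈ thompsonF := by
  classical
  refine ⟨strictMono_homeoOfMonotone _ _ _ _ _ _ _ _,
    {⟨1 / 2, by norm_num, by norm_num⟩, ⟨3 / 4, by norm_num, by norm_num⟩}, ?_, ?_⟩
  · intro b hb
    simp only [Finset.mem_insert, Finset.mem_singleton] at hb
    rcases hb with rfl | rfl
    · exact ⟨1, 1, by norm_num⟩
    · exact ⟨3, 2, by norm_num⟩
  · intro a b hab hB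
    have h1 := hB _ (Finset.mem_insert_self _ _)
    have h2 := hB _ (Finset.mem_insert_of_mem (Finset.mem_singleton_self _))
    simp only [← Subtype.coe_lt_coe, not_and, not_lt] at h1 h2 hab
    have key : ∀ k : ℤ, (∀ s ∈ Set.Icc (a : ℝ) b, ∀ t ∈ Set.Icc (a : ℝ) b,
        x0Fun t - x0Fun s = (2 : ℝ) ^ k * (t - s)) → ∃ k : ℤ, ∀ s ∈ Set.Icc a b,
        ∀ t ∈ Set.Icc a b, (x0Homeo t : ℝ) - x0Homeo s = (2 : ℝ) ^ k * ((t : ℝ) - s) :=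
      fun k hk => ⟨k, fun s hs t ht => hk s hs t ht⟩
    rcases le_or_gt (1 / 2) (a : ℝ) with ha | ha
    · rcases le_or_gt (3 / 4) (a : ℝ) with ha' | ha'
      · refine key 1 ?_
        rintro s ⟨hs, hs'⟩ t ⟨ht, ht'⟩
        unfold x0Fun
        split_ifs <;> norm_num <;> linarith
      · have hb := h2 ha'
        refine key 0 ?_
        rintro s ⟨hs, hs'⟩ t ⟨ht, ht'⟩
        unfold x0Fun
        split_ifs <;> norm_num <;> linarith
    · have hb := h1 ha
      refine key (-1) ?_
      rintro s ⟨hs, hs'⟩ t ⟨ht, ht'⟩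
      unfold x0Fun
      split_ifs <;> norm_num <;> linarith

theorem x1Homeo_mem : x1Homeo ∈ thompsonF := by
  classical
  refine ⟨strictMono_homeoOfMonotone _ _ _ _ _ _ _ _,
    {⟨1 / 2, by norm_num, by norm_num⟩, ⟨3 / 4, by norm_num, by norm_num⟩,
      ⟨7 / 8, by norm_num, by norm_num⟩}, ?_, ?_⟩
  · intro b hb
    simp only [Finset.mem_insert, Finset.mem_singleton] at hb
    rcases hb with rfl | rfl | rfl
    · exact ⟨1, 1, by norm_num⟩
    · exact ⟨3, 2, by norm_num⟩
    · exact ⟨7, 3, by norm_num⟩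
  · intro a b hab hB
    have h1 := hB _ (Finset.mem_insert_self _ _)
    have h2 := hB _ (Finset.mem_insert_of_mem (Finset.mem_insert_self _ _))
    have h3 := hB _ (Finset.mem_insert_of_mem
      (Finset.mem_insert_of_mem (Finset.mem_singleton_self _)))
    simp only [← Subtype.coe_lt_coe, not_and, not_lt] at h1 h2 h3 hab
    have key : ∀ k : ℤ, (∀ s ∈ Set.Icc (a : ℝ) b, ∀ t ∈ Set.Icc (a : ℝ) b,
        x1Fun t - x1Fun s = (2 : ℝ) ^ k * (t - s)) → ∃ k : ℤ, ∀ s ∈ Set.Icc a b,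
        ∀ t ∈ Set.Icc a b, (x1Homeo t : ℝ) - x1Homeo s = (2 : ℝ) ^ k * ((t : ℝ) - s) :=
      fun k hk => ⟨k, fun s hs t ht => hk s hs t ht⟩
    rcases le_or_gt (1 / 2) (a : ℝ) with ha | ha
    · rcases le_or_gt (3 / 4) (a : ℝ) with ha' | ha'
      · rcases le_or_gt (7 / 8) (a : ℝ) with ha'' | ha''
        · refine key 1 ?_
          rintro s ⟨hs, hs'⟩ t ⟨ht, ht'⟩
          unfold x1Fun
          split_ifs <;> norm_num <;> linarith
        · have hb := h3 ha''
          refine key 0 ?_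
          rintro s ⟨hs, hs'⟩ t ⟨ht, ht'⟩
          unfold x1Fun
          split_ifs <;> norm_num <;> linarith
      · have hb := h2 ha'
        refine key (-1) ?_
        rintro s ⟨hs, hs'⟩ t ⟨ht, ht'⟩
        unfold x1Fun
        split_ifs <;> norm_num <;> linarith
    · have hb := h1 ha
      refine key 0 ?_
      rintro s ⟨hs, hs'⟩ t ⟨ht, ht'⟩
      unfold x1Fun
      split_ifs <;> norm_num <;> linarith

/-- The generator `x₀` of `F`. -/
noncomputable def x0 : thompsonF := ⟨x0Homeo, x0Homeo_mem⟩

/-- The generator `x₁` of `F`. -/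
noncomputable def x1 : thompsonF := ⟨x1Homeo, x1Homeo_mem⟩

/-! Near 0 the element x₁ is invisible: it is the identity on [0, 1/2], where x₀ is t ↦ t/2. On an
orbit that stays below 1/2, the generator y = x₀ᵐ uᵐ x₁ thus acts as x₀ᵐ uᵐ. Take a nontrivial
reduced word of length < m in x₀, y and the uᵢ. Substituting aᵐbᵐ for y gives a word of length at
most 2m² in x₀ and the uᵢ, still nontrivial because so few letters cannot destroy an m-th power
(`exists_leadingPower`). By the choice of the uᵢ it moves a point t < ε. Each letter expands the
coordinate by at most 2ᵐ (`grows_substLetter`), so the orbit of t stays below 2^(m²) ε < 1/2, and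
the original word moves t too (`evalWord_fullGen_apply`). Hence the girth is at least m.

The uᵢ come from `exists_no_short_relation`. Every reduced word of length at most N is given its own
trajectory on a grid of dyadic points near 0: x₀ halves, so it changes the scale and keeps the
position on it, while each letter uᵢ or uᵢ⁻¹ is required to advance the position by one. A nonempty
reduced word cannot return to its starting point, since without any uᵢ it is a power of x₀. The
demands on one uᵢ form a finite partial map, increasing because a conflict would need adjacent
inverse letters (`same_sign`), and such a map extends to an element of F (`exists_interpolating`).

Since y yields x₁ back, generation reduces to `closure_x0_x1`: each element of F is given by a pair
of binary trees (`exists_matches_leaves`), and both trees are straightened to the same comb by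
products of x₀ and x₁ (`straightenTail_spec`). -/

/-! ### Affine pieces -/

/-- `f` maps `[a, b]` affinely onto `[c, d]`. -/
def AffOn (f : unitInterval → unitInterval) (a b c d : ℝ) : Prop :=
  ∀ r : ℝ, 0 ≤ r → r ≤ 1 → ∀ t : unitInterval, (t : ℝ) = a + r * (b - a) →
    (f t : ℝ) = c + r * (d - c)

theorem AffOn.comp {f g : unitInterval → unitInterval} {a b c d p q : ℝ}
    (hg : AffOn g c d p q) (hf : AffOn f a b c d) : AffOn (fun t => g (f t)) a b p q :=
  fun r h0 h1 t ht => hg r h0 h1 (f t) (hf r h0 h1 t ht)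

theorem AffOn.sub {f : unitInterval → unitInterval} {a b c d : ℝ} (hf : AffOn f a b c d)
    {α β : ℝ} (hα : 0 ≤ α) (hαβ : α ≤ β) (hβ : β ≤ 1) :
    AffOn f (a + α * (b - a)) (a + β * (b - a)) (c + α * (d - c)) (c + β * (d - c)) := by
  intro r h0 h1 t ht
  have := hf (α + r * (β - α)) (by nlinarith) (by nlinarith) t (by rw [ht]; ring)
  rw [this]; ring

theorem AffOn.congr_ends {f : unitInterval → unitInterval} {a b c d a' b' c' d' : ℝ}
    (hf : AffOn f a b c d) (ha : a = a') (hb : b = b') (hc : c = c') (hd : d = d') :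
    AffOn f a' b' c' d' := by
  subst ha hb hc hd; exact hf

theorem AffOn.left {f : unitInterval → unitInterval} {a b c d : ℝ} (hf : AffOn f a b c d) :
    AffOn f a ((a + b) / 2) c ((c + d) / 2) :=
  (hf.sub (α := 0) (β := 1 / 2) (by norm_num) (by norm_num) (by norm_num)).congr_ends
    (by ring) (by ring) (by ring) (by ring)

theorem AffOn.right {f : unitInterval → unitInterval} {a b c d : ℝ} (hf : AffOn f a b c d) :
    AffOn f ((a + b) / 2) b ((c + d) / 2) d :=
  (hf.sub (α := 1 / 2) (β := 1) (by norm_num) (by norm_num) (by norm_num)).congr_ends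
    (by ring) (by ring) (by ring) (by ring)

theorem affOn_of_fix {f : unitInterval → unitInterval} {a b c : ℝ}
    (h : ∀ t : unitInterval, (t : ℝ) ≤ c → f t = t) (hab : a ≤ b) (hb : b ≤ c) :
    AffOn f a b a b := by
  intro r h0 h1 t ht
  rw [h t (by rw [ht]; nlinarith), ht]

/-- `f` maps the intervals of the list `P` affinely onto the intervals of the list `Q`. -/
def Matches (f : unitInterval → unitInterval) (P Q : List (ℝ × ℝ)) : Prop :=
  List.Forall₂ (fun p q => AffOn f p.1 p.2 q.1 q.2) P Q

theorem Matches.comp {f g : unitInterval → unitInterval} {P Q R : List (ℝ × ℝ)}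
    (hg : Matches g Q R) (hf : Matches f P Q) : Matches (fun t => g (f t)) P R := by
  induction hf generalizing R with
  | nil => cases hg; exact List.Forall₂.nil
  | cons h _ ih =>
    cases hg with
    | cons h' ht => exact List.Forall₂.cons (AffOn.comp h' h) (ih ht)

theorem Matches.append {f : unitInterval → unitInterval} {P Q P' Q' : List (ℝ × ℝ)}
    (h : Matches f P Q) (h' : Matches f P' Q') : Matches f (P ++ P') (Q ++ Q') :=
  List.rel_append h h'

/-! ### Dyadic subdivisions given by binary trees -/

/-- Finite rooted binary trees. -/
inductive BinTree
  | leaf : BinTree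
  | node : BinTree → BinTree → BinTree

namespace BinTree

/-- The intervals of the subdivision of `[a, b]` given by a tree. -/
noncomputable def leaves : BinTree → ℝ → ℝ → List (ℝ × ℝ)
  | leaf, a, b => [(a, b)]
  | node L R, a, b => L.leaves a ((a + b) / 2) ++ R.leaves ((a + b) / 2) b

/-- The number of leaves. -/
def size : BinTree → ℕ
  | leaf => 1
  | node L R => L.size + R.size

/-- The number of inner nodes. -/
def carets : BinTree → ℕ
  | leaf => 0
  | node L R => L.size + R.carets

theorem size_eq (T : BinTree) : T.size = T.carets + 1 := by
  induction T with
  | leaf => rfl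
  | node L R _ ih => simp only [size, carets, ih]; omega

theorem length_leaves (T : BinTree) (a b : ℝ) : (T.leaves a b).length = T.size := by
  induction T generalizing a b with
  | leaf => rfl
  | node L R ihL ihR => simp [leaves, size, ihL, ihR]

theorem exists_mem_leaves (T : BinTree) {a b t : ℝ} (hab : a < b) (ha : a ≤ t) (hb : t ≤ b) :
    ∃ p ∈ T.leaves a b, p.1 < p.2 ∧ p.1 ≤ t ∧ t ≤ p.2 := by
  induction T generalizing a b with
  | leaf => exact ⟨(a, b), by simp [leaves], hab, ha, hb⟩
  | node L R ihL ihR =>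
    rcases le_total t ((a + b) / 2) with h | h
    · obtain ⟨p, hp, h'⟩ := ihL (by linarith) ha h
      exact ⟨p, by simp [leaves, hp], h'⟩
    · obtain ⟨p, hp, h'⟩ := ihR (by linarith) h hb
      exact ⟨p, by simp [leaves, hp], h'⟩

theorem matches_leaves (T : BinTree) {f : unitInterval → unitInterval} {a b c d : ℝ}
    (h : AffOn f a b c d) : Matches f (T.leaves a b) (T.leaves c d) := by
  induction T generalizing a b c d with
  | leaf => exact List.Forall₂.cons h List.Forall₂.nil
  | node L R ihL ihR => exact (ihL h.left).append (ihR h.right)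

end BinTree

theorem eqAt_of_matches {f g : unitInterval → unitInterval} {P Q : List (ℝ × ℝ)}
    (hf : Matches f P Q) (hg : Matches g P Q) {p : ℝ × ℝ} (hp : p ∈ P) (hlt : p.1 < p.2)
    {t : unitInterval} (h1 : p.1 ≤ t) (h2 : t ≤ p.2) : f t = g t := by
  induction hf with
  | nil => simp at hp
  | cons h _ ih =>
    cases hg with
    | cons h' ht =>
      rcases List.mem_cons.1 hp with rfl | hp
      · have hpos : 0 < p.2 - p.1 := by linarith
        have e : (t : ℝ) = p.1 + ((t - p.1) / (p.2 - p.1)) * (p.2 - p.1) := by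
          field_simp; ring
        have h0 : 0 ≤ ((t : ℝ) - p.1) / (p.2 - p.1) := div_nonneg (by linarith) hpos.le
        have h1' : ((t : ℝ) - p.1) / (p.2 - p.1) ≤ 1 := by rw [div_le_one hpos]; linarith
        exact Subtype.ext ((h _ h0 h1' t e).trans (h' _ h0 h1' t e).symm)
      · exact ih ht hp

theorem eq_of_matches_leaves {f g : thompsonF} {T : BinTree} {Q : List (ℝ × ℝ)}
    (hf : Matches f.1 (T.leaves 0 1) Q) (hg : Matches g.1 (T.leaves 0 1) Q) : f = g := by
  refine Subtype.ext (Homeomorph.ext fun t => ?_)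
  obtain ⟨p, hp, hlt, h1, h2⟩ := T.exists_mem_leaves zero_lt_one t.2.1 t.2.2
  exact eqAt_of_matches hf hg hp hlt h1 h2

/-! ### The right comb -/

/-- The break points `1 - 2⁻ʲ` of the right comb. -/
noncomputable def combPt (j : ℕ) : ℝ := 1 - (1 / 2) ^ j

theorem combPt_zero : combPt 0 = 0 := by simp [combPt]

theorem combPt_succ (j : ℕ) : combPt (j + 1) = (combPt j + 1) / 2 := by
  simp only [combPt, pow_succ]; ring

theorem combPt_lt_one (j : ℕ) : combPt j < 1 := by
  simp only [combPt]; have : (0 : ℝ) < (1 / 2) ^ j := by positivity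
  linarith

theorem combPt_le_succ (j : ℕ) : combPt j ≤ combPt (j + 1) := by
  rw [combPt_succ]; linarith [combPt_lt_one j]

theorem combPt_nonneg (j : ℕ) : 0 ≤ combPt j := by
  induction j with
  | zero => rw [combPt_zero]
  | succ j ih => exact ih.trans (combPt_le_succ j)

/-- The `n` intervals of the comb that start at `combPt j`. -/
noncomputable def comb : ℕ → ℕ → List (ℝ × ℝ)
  | _, 0 => []
  | j, n + 1 => (combPt j, combPt (j + 1)) :: comb (j + 1) n

/-- The subdivision of `[combPt j, 1]` by the next `n` comb points. -/
noncomputable def combTail (j n : ℕ) : List (ℝ × ℝ) := comb j n ++ [(combPt (j + n), 1)]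

theorem comb_add (j p q : ℕ) : comb j (p + q) = comb j p ++ comb (j + p) q := by
  induction p generalizing j with
  | zero => simp [comb]
  | succ p ih =>
    rw [Nat.add_right_comm, comb, comb, ih]
    simp only [List.cons_append]
    congr 3
    ring

theorem comb_append_combTail (j p q : ℕ) :
    comb j p ++ combTail (j + p) q = combTail j (p + q) := by
  simp [combTail, comb_add, Nat.add_assoc]

theorem affOn_combTail_step {f : unitInterval → unitInterval} {p q : ℕ}
    (h : AffOn f (combPt p) 1 (combPt q) 1) :
    AffOn f (combPt p) (combPt (p + 1)) (combPt q) (combPt (q + 1)) ∧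
      AffOn f (combPt (p + 1)) 1 (combPt (q + 1)) 1 := by
  rw [combPt_succ, combPt_succ]
  exact ⟨h.left, h.right⟩

theorem affOn_combTail_add {f : unitInterval → unitInterval} {p q : ℕ} (n : ℕ)
    (h : AffOn f (combPt p) 1 (combPt q) 1) : AffOn f (combPt (p + n)) 1 (combPt (q + n)) 1 := by
  induction n with
  | zero => exact h
  | succ n ih => exact (affOn_combTail_step ih).2

theorem matches_comb {f : unitInterval → unitInterval} {p q : ℕ} (n : ℕ)
    (h : AffOn f (combPt p) 1 (combPt q) 1) : Matches f (comb p n) (comb q n) := by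
  induction n generalizing p q with
  | zero => exact List.Forall₂.nil
  | succ n ih =>
    exact List.Forall₂.cons (affOn_combTail_step h).1 (ih (affOn_combTail_step h).2)

theorem matches_combTail {f : unitInterval → unitInterval} {p q : ℕ} (n : ℕ)
    (h : AffOn f (combPt p) 1 (combPt q) 1) : Matches f (combTail p n) (combTail q n) :=
  (matches_comb n h).append (List.Forall₂.cons (affOn_combTail_add n h) List.Forall₂.nil)

/-! ### The generators `xₙ` and the subgroup generated by `x₀` and `x₁` -/

theorem x0_apply (t : unitInterval) : ((x0.1 t : unitInterval) : ℝ) = x0Fun t := rfl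

theorem x0_inv_apply (t : unitInterval) : (((x0⁻¹ : thompsonF).1 t : unitInterval) : ℝ) = x0Inv t :=
  rfl

theorem x1_apply (t : unitInterval) : ((x1.1 t : unitInterval) : ℝ) = x1Fun t := rfl

theorem x1_inv_apply (t : unitInterval) : (((x1⁻¹ : thompsonF).1 t : unitInterval) : ℝ) = x1Inv t :=
  rfl

/-- The infinite sequence of standard generators. -/
noncomputable def xSeq : ℕ → thompsonF
  | 0 => x0
  | 1 => x1
  | n + 2 => x0⁻¹ * xSeq (n + 1) * x0

theorem affOn_x0 {a b : ℝ} (ha : 1 / 2 ≤ a) (hab : a ≤ b) :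
    AffOn x0.1 ((a + 1) / 2) ((b + 1) / 2) a b := by
  intro r h0 h1 t ht
  have : (a + 1) / 2 ≤ t := by rw [ht]; nlinarith
  rw [x0_apply]; unfold x0Fun
  rw [if_neg (by linarith)]
  split_ifs <;> nlinarith

theorem affOn_x0_inv {a b : ℝ} (ha : 1 / 2 ≤ a) (hab : a ≤ b) :
    AffOn (x0⁻¹ : thompsonF).1 a b ((a + 1) / 2) ((b + 1) / 2) := by
  intro r h0 h1 t ht
  have : a ≤ t := by rw [ht]; nlinarith
  rw [x0_inv_apply]; unfold x0Inv
  rw [if_neg (by linarith)]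
  split_ifs <;> nlinarith

/-- On [1/2, 1] the map x₀⁻¹ is t ↦ (t + 1)/2, which carries `combPt j` to `combPt (j + 1)`.
Conjugation therefore raises comb indices by one. -/
theorem AffOn.conj_x0 {f : unitInterval → unitInterval} {a b c d : ℝ} (h : AffOn f a b c d)
    (ha : 1 / 2 ≤ a) (hab : a ≤ b) (hc : 1 / 2 ≤ c) (hcd : c ≤ d) :
    AffOn (fun t => (x0⁻¹ : thompsonF).1 (f (x0.1 t))) ((a + 1) / 2) ((b + 1) / 2)
      ((c + 1) / 2) ((d + 1) / 2) :=
  ((affOn_x0_inv hc hcd).comp h).comp (affOn_x0 ha hab)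

/-- The map `[c_j, 1] → [c_j, 1]` that opens the first comb interval at its midpoint. -/
def OpensAt (f : unitInterval → unitInterval) (j : ℕ) : Prop :=
  (∀ t : unitInterval, (t : ℝ) ≤ combPt j → f t = t) ∧
  AffOn f (combPt j) ((combPt j + combPt (j + 1)) / 2) (combPt j) (combPt (j + 1)) ∧
  AffOn f ((combPt j + combPt (j + 1)) / 2) (combPt (j + 1)) (combPt (j + 1)) (combPt (j + 2)) ∧
  AffOn f (combPt (j + 1)) 1 (combPt (j + 2)) 1

/-- The cases 0 and 1 are read off the graphs; from 1 on, the break points lie in [1/2, 1] and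
`AffOn.conj_x0` shifts them. -/
theorem opensAt_xSeq_inv (j : ℕ) : OpensAt ((xSeq j)⁻¹ : thompsonF).1 j := by
  induction j using Nat.strong_induction_on with
  | _ j ih =>
    match j with
    | 0 =>
      refine ⟨?_, ?_, ?_, ?_⟩
      · intro t ht
        rw [combPt_zero] at ht
        have : t = 0 := le_antisymm ht unitInterval.nonneg'
        subst this
        exact (x0⁻¹ : thompsonF).2.1.map_zero_unitInterval
      all_goals
        intro r h0 h1 t ht
        norm_num [combPt] at ht ⊢
        change (((x0⁻¹ : thompsonF).1 t : unitInterval) : ℝ) = _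
        rw [x0_inv_apply]; unfold x0Inv
        split_ifs <;> nlinarith
    | 1 =>
      refine ⟨?_, ?_, ?_, ?_⟩
      · intro t ht
        norm_num [combPt] at ht
        refine Subtype.ext ?_
        change (((x1⁻¹ : thompsonF).1 t : unitInterval) : ℝ) = _
        rw [x1_inv_apply]; unfold x1Inv
        rw [if_pos ht]
      all_goals
        intro r h0 h1 t ht
        norm_num [combPt] at ht ⊢
        change (((x1⁻¹ : thompsonF).1 t : unitInterval) : ℝ) = _
        rw [x1_inv_apply]; unfold x1Inv
        split_ifs <;> nlinarith
    | n + 2 =>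
      obtain ⟨h1, h2, h3, h4⟩ := ih (n + 1) (by omega)
      have e : ((xSeq (n + 2))⁻¹ : thompsonF).1 =
          fun t => (x0⁻¹ : thompsonF).1 (((xSeq (n + 1))⁻¹ : thompsonF).1 (x0.1 t)) := by
        have : (xSeq (n + 2))⁻¹ = x0⁻¹ * (xSeq (n + 1))⁻¹ * x0 := by
          rw [xSeq]; group
        rw [this]; rfl
      rw [e]
      have c1 : combPt (n + 1 + 1) = (combPt (n + 1) + 1) / 2 := combPt_succ _
      have c2 : combPt (n + 2 + 1) = (combPt (n + 2) + 1) / 2 := combPt_succ _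
      have c3 : combPt (n + 2 + 2) = (combPt (n + 2 + 1) + 1) / 2 := combPt_succ _
      have c0 : combPt (n + 1) = (combPt n + 1) / 2 := combPt_succ _
      have p0 := combPt_nonneg n
      have p1 := combPt_lt_one n
      simp only [show n + 1 + 2 = n + 2 + 1 from rfl, show n + 1 + 1 = n + 2 from rfl] at *
      refine ⟨?_, ?_, ?_, ?_⟩
      · intro t ht
        have : ((x0.1 t : unitInterval) : ℝ) ≤ combPt (n + 1) := by
          rw [x0_apply]; unfold x0Fun
          split_ifs <;> linarith
        simp only
        rw [h1 _ this]
        exact x0.1.symm_apply_apply t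
      · refine (h2.conj_x0 ?_ ?_ ?_ ?_).congr_ends ?_ ?_ ?_ ?_ <;> linarith
      · refine (h3.conj_x0 ?_ ?_ ?_ ?_).congr_ends ?_ ?_ ?_ ?_ <;> linarith
      · refine (h4.conj_x0 ?_ ?_ ?_ ?_).congr_ends ?_ ?_ ?_ ?_ <;> linarith

theorem xSeq_mem (j : ℕ) : xSeq j ∈ Subgroup.closure {x0, x1} := by
  have m0 : x0 ∈ Subgroup.closure {x0, x1} := Subgroup.subset_closure (by simp)
  have m1 : x1 ∈ Subgroup.closure {x0, x1} := Subgroup.subset_closure (by simp)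
  induction j using Nat.strong_induction_on with
  | _ j ih =>
    match j with
    | 0 => exact m0
    | 1 => exact m1
    | n + 2 => exact mul_mem (mul_mem (inv_mem m0) (ih (n + 1) (by omega))) m0

/-- The element that maps the subdivision `T` of the `j`-th comb interval to the comb. -/
noncomputable def straighten : ℕ → BinTree → thompsonF
  | _, .leaf => 1
  | j, .node L R => straighten j L * straighten (j + 1) R * (xSeq j)⁻¹

/-- The element that maps the subdivision `T` of `[c_j, 1]` to the comb. -/
noncomputable def straightenTail : ℕ → BinTree → thompsonF
  | _, .leaf => 1
  | j, .node L R => straighten j L * straightenTail (j + 1) R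

theorem straighten_mem (j : ℕ) (T : BinTree) : straighten j T ∈ Subgroup.closure {x0, x1} := by
  induction T generalizing j with
  | leaf => exact one_mem _
  | node L R ihL ihR => exact mul_mem (mul_mem (ihL j) (ihR (j + 1))) (inv_mem (xSeq_mem j))

theorem straightenTail_mem (j : ℕ) (T : BinTree) :
    straightenTail j T ∈ Subgroup.closure {x0, x1} := by
  induction T generalizing j with
  | leaf => exact one_mem _
  | node L R _ ihR => exact mul_mem (straighten_mem j L) (ihR (j + 1))

/-- Opening the interval at its midpoint makes it the comb intervals j and j + 1. The tree R is
straightened first, by an element that fixes [0, c_{j+1}]; the element of L then carries the rest of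
the comb along affinely. This last effect is the third clause, needed to run the induction. -/
theorem straighten_spec (j : ℕ) (T : BinTree) :
    (∀ t : unitInterval, (t : ℝ) ≤ combPt j → (straighten j T).1 t = t) ∧
    Matches (straighten j T).1 (T.leaves (combPt j) (combPt (j + 1))) (comb j T.size) ∧
    AffOn (straighten j T).1 (combPt (j + 1)) 1 (combPt (j + T.size)) 1 := by
  induction T generalizing j with
  | leaf =>
    have h : ∀ t : unitInterval, (t : ℝ) ≤ 1 → (straighten j .leaf).1 t = t := fun _ _ => rfl
    refine ⟨fun _ _ => rfl, List.Forall₂.cons ?_ List.Forall₂.nil, ?_⟩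
    · exact affOn_of_fix h (combPt_le_succ j) (combPt_lt_one _).le
    · exact affOn_of_fix h (combPt_lt_one _).le le_rfl
  | node L R ihL ihR =>
    obtain ⟨o1, o2, o3, o4⟩ := opensAt_xSeq_inv j
    obtain ⟨l1, l2, l3⟩ := ihL j
    obtain ⟨r1, r2, r3⟩ := ihR (j + 1)
    have e : (straighten j (.node L R)).1 = fun t => (straighten j L).1
        ((straighten (j + 1) R).1 (((xSeq j)⁻¹ : thompsonF).1 t)) := rfl
    have a : j + 1 + R.size = j + 1 + (R.carets + 1) := by rw [R.size_eq]
    rw [e]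
    refine ⟨?_, ?_, ?_⟩
    · intro t ht
      simp only
      rw [o1 t ht, r1 t (ht.trans (combPt_le_succ j)), l1 t ht]
    · simp only [BinTree.leaves, BinTree.size, comb_add]
      refine Matches.append ?_ ?_
      · exact (l2.comp (BinTree.matches_leaves L
          (affOn_of_fix r1 (combPt_le_succ j) le_rfl))).comp (BinTree.matches_leaves L o2)
      · exact ((matches_comb _ l3).comp r2).comp (BinTree.matches_leaves R o3)
    · have l3' := affOn_combTail_add R.size l3
      have := (l3'.comp r3).comp o4
      rwa [Nat.add_assoc] at this

/-- The midpoint of [c_j, 1] is already c_{j+1}, so a caret on the right spine costs no generator.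
-/
theorem straightenTail_spec (j : ℕ) (T : BinTree) :
    (∀ t : unitInterval, (t : ℝ) ≤ combPt j → (straightenTail j T).1 t = t) ∧
    Matches (straightenTail j T).1 (T.leaves (combPt j) 1) (combTail j T.carets) := by
  induction T generalizing j with
  | leaf =>
    have h : ∀ t : unitInterval, (t : ℝ) ≤ 1 → (straightenTail j .leaf).1 t = t := fun _ _ => rfl
    exact ⟨fun _ _ => rfl, List.Forall₂.cons
      (affOn_of_fix h (combPt_lt_one _).le le_rfl) List.Forall₂.nil⟩
  | node L R _ ihR =>
    obtain ⟨l1, l2, l3⟩ := straighten_spec j L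
    obtain ⟨r1, r2⟩ := ihR (j + 1)
    have e : (straightenTail j (.node L R)).1 = fun t => (straighten j L).1
        ((straightenTail (j + 1) R).1 t) := rfl
    rw [e]
    refine ⟨?_, ?_⟩
    · intro t ht
      simp only
      rw [r1 t (ht.trans (combPt_le_succ j)), l1 t ht]
    · simp only [BinTree.leaves, BinTree.carets, ← comb_append_combTail]
      rw [← combPt_succ]
      refine Matches.append ?_ ?_
      · exact l2.comp (BinTree.matches_leaves L (affOn_of_fix r1 (combPt_le_succ j) le_rfl))
      · exact (matches_combTail _ l3).comp r2

/-- Equal numbers of leaves mean that T and R straighten to the same comb, so f is a quotient of the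
two straightening elements. -/
theorem mem_closure_of_matches {f : thompsonF} {T R : BinTree}
    (h : Matches f.1 (T.leaves 0 1) (R.leaves 0 1)) : f ∈ Subgroup.closure {x0, x1} := by
  have hc : T.carets = R.carets := by
    have := h.length_eq
    rw [T.length_leaves, R.length_leaves, T.size_eq, R.size_eq] at this
    omega
  have hT := (straightenTail_spec 0 T).2
  have hR := (straightenTail_spec 0 R).2
  rw [combPt_zero] at hT hR
  rw [hc] at hT
  have e : straightenTail 0 R * f = straightenTail 0 T := eq_of_matches_leaves (hR.comp h) hT
  rw [← inv_mul_eq_iff_eq_mul.2 e.symm]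
  exact mul_mem (inv_mem (straightenTail_mem 0 R)) (straightenTail_mem 0 T)

/-! ### Partitions into standard dyadic intervals -/

/-- `[a, b] = [i / 2ⁿ, (i + 1) / 2ⁿ]` for integers `i` and `n ≥ 0`. -/
def IsStd (a b : ℝ) : Prop := ∃ (i : ℤ) (n : ℕ), a = i / 2 ^ n ∧ b = (i + 1) / 2 ^ n

theorem IsStd.lt {a b : ℝ} (h : IsStd a b) : a < b := by
  obtain ⟨i, n, rfl, rfl⟩ := h
  gcongr
  linarith

theorem IsStd.left {a b : ℝ} (h : IsStd a b) : IsStd a ((a + b) / 2) := by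
  obtain ⟨i, n, rfl, rfl⟩ := h
  refine ⟨2 * i, n + 1, ?_, ?_⟩
  · push_cast; rw [pow_succ]; field_simp
  · push_cast; rw [pow_succ]; field_simp; ring

theorem IsStd.right {a b : ℝ} (h : IsStd a b) : IsStd ((a + b) / 2) b := by
  obtain ⟨i, n, rfl, rfl⟩ := h
  refine ⟨2 * i + 1, n + 1, ?_, ?_⟩ <;> push_cast <;> rw [pow_succ] <;> field_simp <;> ring

/-- A standard interval shorter than `[a, b]` does not contain the midpoint of `[a, b]` in its
interior. -/
theorem IsStd.not_mem_midpoint {a b c d : ℝ} (h : IsStd a b) (h' : IsStd c d)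
    (hl : d - c < b - a) : ¬ (c < (a + b) / 2 ∧ (a + b) / 2 < d) := by
  obtain ⟨i, n, rfl, rfl⟩ := h
  obtain ⟨j, l, rfl, rfl⟩ := h'
  have e1 : ((j : ℝ) + 1) / 2 ^ l - j / 2 ^ l = 1 / 2 ^ l := by ring
  have e2 : ((i : ℝ) + 1) / 2 ^ n - i / 2 ^ n = 1 / 2 ^ n := by ring
  rw [e1, e2, one_div_lt_one_div (by positivity) (by positivity)] at hl
  have hnl : n < l := (pow_lt_pow_iff_right₀ (by norm_num)).1 hl
  obtain ⟨q, rfl⟩ := Nat.exists_eq_add_of_lt hnl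
  -- The shorter interval has l > n, so the midpoint is a multiple of 2⁻ˡ, and no such multiple lies
  -- strictly between j / 2ˡ and (j + 1) / 2ˡ.
  have e3 : ((i : ℝ) / 2 ^ n + (i + 1) / 2 ^ n) / 2
      = (((2 * i + 1) * 2 ^ q : ℤ) : ℝ) / 2 ^ (n + q + 1) := by
    push_cast; rw [pow_succ, pow_add]; field_simp; ring
  rw [e3]
  rintro ⟨h1, h2⟩
  rw [div_lt_div_iff_of_pos_right (by positivity)] at h1 h2
  have h2' : (((2 * i + 1) * 2 ^ q : ℤ) : ℝ) < ((j + 1 : ℤ) : ℝ) := by push_cast at h2 ⊢; exact h2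
  have h1' := Int.cast_lt.1 h1
  have h2'' := Int.cast_lt.1 h2'
  omega

/-- The list `P` consists of consecutive intervals from `a` to `b`. -/
inductive Chained : ℝ → List (ℝ × ℝ) → ℝ → Prop
  | nil (a : ℝ) : Chained a [] a
  | cons {a b c : ℝ} {P : List (ℝ × ℝ)} : Chained b P c → Chained a ((a, b) :: P) c

theorem Chained.eq_of_nil {a b : ℝ} (h : Chained a [] b) : a = b := by cases h; rfl

theorem Chained.append {a b c : ℝ} {P Q : List (ℝ × ℝ)} (h : Chained a P b) (h' : Chained b Q c) :
    Chained a (P ++ Q) c := by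
  induction h with
  | nil => exact h'
  | cons _ ih => exact Chained.cons (ih h')

theorem Chained.bounds {a c : ℝ} {P : List (ℝ × ℝ)} (h : Chained a P c)
    (hlt : ∀ p ∈ P, p.1 < p.2) : a ≤ c ∧ ∀ p ∈ P, a ≤ p.1 ∧ p.2 ≤ c := by
  induction h with
  | nil => simp
  | cons h ih =>
    obtain ⟨h1, h2⟩ := ih fun p hp => hlt p (List.mem_cons_of_mem _ hp)
    have h3 := hlt _ List.mem_cons_self
    simp only at h3
    refine ⟨by linarith, fun p hp => ?_⟩
    rcases List.mem_cons.1 hp with rfl | hp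
    · exact ⟨le_rfl, h1⟩
    · exact ⟨h3.le.trans (h2 p hp).1, (h2 p hp).2⟩

theorem Chained.split {a c m : ℝ} {P : List (ℝ × ℝ)} (h : Chained a P c) (ha : a ≤ m) (hc : m ≤ c)
    (hm : ∀ p ∈ P, ¬ (p.1 < m ∧ m < p.2)) :
    ∃ P₁ P₂, P = P₁ ++ P₂ ∧ Chained a P₁ m ∧ Chained m P₂ c := by
  induction h with
  | nil a =>
    obtain rfl := le_antisymm ha hc
    exact ⟨[], [], rfl, .nil _, .nil _⟩
  | @cons a b c P h ih =>
    rcases ha.eq_or_lt with rfl | ha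
    · exact ⟨[], _, rfl, .nil _, .cons h⟩
    · have hb : b ≤ m := not_lt.1 fun hb => hm _ List.mem_cons_self ⟨ha, hb⟩
      obtain ⟨P₁, P₂, rfl, h1, h2⟩ := ih hb hc fun p hp => hm p (List.mem_cons_of_mem _ hp)
      exact ⟨(a, b) :: P₁, P₂, rfl, .cons h1, h2⟩

/-- If there are at least two pieces, each is shorter than [a, c], so by `IsStd.not_mem_midpoint`
the partition can be cut at the midpoint into partitions of two standard halves with fewer pieces.
-/
theorem Chained.exists_leaves {a c : ℝ} {P : List (ℝ × ℝ)} (h : Chained a P c) (hac : IsStd a c)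
    (hstd : ∀ p ∈ P, IsStd p.1 p.2) : ∃ T : BinTree, T.leaves a c = P := by
  generalize hn : P.length = n
  induction n using Nat.strong_induction_on generalizing P a c with
  | _ n ih =>
    cases h with
    | nil => exact absurd hac.lt (lt_irrefl _)
    | @cons _ b _ P h =>
      by_cases hP : P = []
      · subst hP; cases h
        exact ⟨.leaf, rfl⟩
      have hlt : ∀ p ∈ P, p.1 < p.2 := fun p hp => (hstd p (List.mem_cons_of_mem _ hp)).lt
      have hab : a < b := (hstd _ List.mem_cons_self).lt
      obtain ⟨-, hb2⟩ := h.bounds hlt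
      have hbc : b < c := by
        obtain ⟨p, hp⟩ := List.exists_mem_of_ne_nil P hP
        linarith [hb2 p hp, hlt p hp]
      have hno : ∀ p ∈ (a, b) :: P, ¬ (p.1 < (a + c) / 2 ∧ (a + c) / 2 < p.2) := by
        intro p hp
        refine hac.not_mem_midpoint (hstd p hp) ?_
        rcases List.mem_cons.1 hp with rfl | hp
        · simp only; linarith
        · linarith [hb2 p hp]
      have hac' := hac.lt
      obtain ⟨P₁, P₂, e, h1, h2⟩ := (Chained.cons h).split (a := a) (m := (a + c) / 2)
        (by linarith) (by linarith) hno
      have l1 : P₁ ≠ [] := by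
        rintro rfl; linarith [h1.eq_of_nil]
      have l2 : P₂ ≠ [] := by
        rintro rfl; linarith [h2.eq_of_nil]
      have l := congrArg List.length e
      rw [hn, List.length_append] at l
      have l1' := List.length_pos_iff.2 l1
      have l2' := List.length_pos_iff.2 l2
      obtain ⟨T₁, t1⟩ := ih P₁.length (by omega) h1 hac.left
        (fun p hp => hstd p (e ▸ List.mem_append_left _ hp)) rfl
      obtain ⟨T₂, t2⟩ := ih P₂.length (by omega) h2 hac.right
        (fun p hp => hstd p (e ▸ List.mem_append_right _ hp)) rfl
      exact ⟨.node T₁ T₂, by rw [BinTree.leaves, t1, t2, e]⟩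

/-! ### Tree pair diagrams of the elements of `F` -/

/-- `f` maps the intervals of a dyadic subdivision of `[a, b]` affinely onto consecutive standard
intervals from `c` to `d`. -/
def Splits (f : unitInterval → unitInterval) (a b c d : ℝ) : Prop :=
  ∃ (T : BinTree) (Q : List (ℝ × ℝ)), Matches f (T.leaves a b) Q ∧ Chained c Q d ∧
    ∀ p ∈ Q, IsStd p.1 p.2

theorem AffOn.splits {f : unitInterval → unitInterval} {a b c d : ℝ} (h : AffOn f a b c d)
    (hcd : IsStd c d) : Splits f a b c d :=
  ⟨.leaf, [(c, d)], List.Forall₂.cons h List.Forall₂.nil, .cons (.nil d), by simpa using hcd⟩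

theorem Splits.join {f : unitInterval → unitInterval} {a b c d e : ℝ}
    (h : Splits f a ((a + b) / 2) c e) (h' : Splits f ((a + b) / 2) b e d) : Splits f a b c d := by
  obtain ⟨T, Q, h1, h2, h3⟩ := h
  obtain ⟨T', Q', h1', h2', h3'⟩ := h'
  refine ⟨.node T T', Q ++ Q', h1.append h1', h2.append h2', fun p hp => ?_⟩
  rcases List.mem_append.1 hp with hp | hp
  · exact h3 p hp
  · exact h3' p hp

/-- The real function that extends a self-map of the unit interval. -/
noncomputable def realExt (f : unitInterval → unitInterval) (t : ℝ) : ℝ :=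
  f (Set.projIcc 0 1 zero_le_one t)

theorem realExt_coe (f : unitInterval → unitInterval) (t : unitInterval) :
    realExt f t = f t := by
  simp [realExt]

/-- Neighbouring intervals of depth N + 1 are glued in pairs, so the induction climbs towards the
root. -/
theorem splits_zero_one {f : unitInterval → unitInterval} (N : ℕ)
    (h : ∀ j : ℕ, j < 2 ^ N → Splits f (j / 2 ^ N) ((j + 1) / 2 ^ N)
      (realExt f (j / 2 ^ N)) (realExt f ((j + 1) / 2 ^ N))) :
    Splits f 0 1 (realExt f 0) (realExt f 1) := by
  induction N with
  | zero => simpa using h 0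
  | succ N ih =>
    refine ih fun j hj => ?_
    have hj1 := h (2 * j) (by rw [pow_succ]; omega)
    have hj2 := h (2 * j + 1) (by rw [pow_succ]; omega)
    have e1 : ((2 * j : ℕ) : ℝ) / 2 ^ (N + 1) = j / 2 ^ N := by
      push_cast; rw [pow_succ]; field_simp
    have e2 : (((2 * j : ℕ) : ℝ) + 1) / 2 ^ (N + 1) = (j / 2 ^ N + (j + 1) / 2 ^ N) / 2 := by
      push_cast; rw [pow_succ]; field_simp; ring
    have e3 : ((2 * j + 1 : ℕ) : ℝ) / 2 ^ (N + 1) = (j / 2 ^ N + (j + 1) / 2 ^ N) / 2 := by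
      push_cast; rw [pow_succ]; field_simp; ring
    have e4 : (((2 * j + 1 : ℕ) : ℝ) + 1) / 2 ^ (N + 1) = (j + 1) / 2 ^ N := by
      push_cast; rw [pow_succ]; field_simp; ring
    rw [e1, e2] at hj1
    rw [e3, e4] at hj2
    exact hj1.join hj2

/-- On a piece of slope 2ᵏ, neighbours in the grid of mesh 2⁻ᴾ have images at distance 2^(k-P). For
large P the image of the left end point lies on the grid of that mesh, so all images do. The form
"for all large P" lets one P serve finitely many pieces. -/
theorem eventually_affOn_isStd {f : unitInterval → unitInterval} {i N : ℕ} {k : ℤ}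
    (hd : IsDyadic (realExt f (i / 2 ^ N)))
    (hk : ∀ s t : ℝ, (i : ℝ) / 2 ^ N ≤ s → s ≤ (i + 1) / 2 ^ N → (i : ℝ) / 2 ^ N ≤ t →
      t ≤ (i + 1) / 2 ^ N → realExt f t - realExt f s = (2 : ℝ) ^ k * (t - s)) :
    ∀ᶠ P : ℕ in atTop, N ≤ P ∧ ∀ j : ℕ, i * 2 ^ (P - N) ≤ j → j < (i + 1) * 2 ^ (P - N) →
      AffOn f (j / 2 ^ P) ((j + 1) / 2 ^ P) (realExt f (j / 2 ^ P)) (realExt f ((j + 1) / 2 ^ P)) ∧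
      IsStd (realExt f (j / 2 ^ P)) (realExt f ((j + 1) / 2 ^ P)) := by
  obtain ⟨c, M, hc⟩ := hd
  filter_upwards [eventually_ge_atTop N, eventually_ge_atTop (M + k.toNat)] with P hP hP'
  refine ⟨hP, fun j hj hj' => ?_⟩
  obtain ⟨e, rfl⟩ := Nat.exists_eq_add_of_le hP
  rw [Nat.add_sub_cancel_left] at hj hj'
  have hjr : (i : ℝ) * 2 ^ e ≤ j := by exact_mod_cast hj
  have hjr' : (j : ℝ) + 1 ≤ (i + 1) * 2 ^ e := by exact_mod_cast hj'
  have b1 : (i : ℝ) / 2 ^ N ≤ j / 2 ^ (N + e) := by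
    rw [div_le_div_iff₀ (by positivity) (by positivity), pow_add]
    calc (i : ℝ) * (2 ^ N * 2 ^ e) = i * 2 ^ e * 2 ^ N := by ring
      _ ≤ _ := by gcongr
  have b2 : ((j : ℝ) + 1) / 2 ^ (N + e) ≤ (i + 1) / 2 ^ N := by
    rw [div_le_div_iff₀ (by positivity) (by positivity), pow_add]
    calc ((j : ℝ) + 1) * 2 ^ N ≤ ((i + 1) * 2 ^ e) * 2 ^ N := by gcongr
      _ = _ := by ring
  have b3 : (j : ℝ) / 2 ^ (N + e) ≤ (j + 1) / 2 ^ (N + e) := by gcongr; linarith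
  have b4 : (i : ℝ) / 2 ^ N ≤ (i + 1) / 2 ^ N := by gcongr; linarith
  constructor
  · intro r h0 h1 t ht
    have t1 : (j : ℝ) / 2 ^ (N + e) ≤ t := by rw [ht]; nlinarith
    have t2 : (t : ℝ) ≤ (j + 1) / 2 ^ (N + e) := by rw [ht]; nlinarith
    have q1 := hk (j / 2 ^ (N + e)) t b1 (b3.trans b2) (b1.trans t1) (t2.trans b2)
    have q2 := hk (j / 2 ^ (N + e)) ((j + 1) / 2 ^ (N + e)) b1 (b3.trans b2) (b1.trans b3) b2
    rw [realExt_coe, ht] at q1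
    rw [q2]
    linear_combination q1
  -- Here q + M = P - k for P = N + e; the bound P ≥ M + max(k, 0) makes q nonnegative.
  · obtain ⟨q, hq⟩ : ∃ q : ℕ, (q : ℤ) = N + e - k - M :=
      ⟨(N + e - k - M : ℤ).toNat, Int.toNat_of_nonneg (by omega)⟩
    have hz : (2 : ℝ) ^ (q + M) = 2 ^ (N + e) / 2 ^ k := by
      rw [← zpow_natCast, ← zpow_natCast, ← zpow_sub₀ two_ne_zero]
      congr 1; push_cast; omega
    have hk0 : (0 : ℝ) < 2 ^ k := by positivity
    have q1 := hk (i / 2 ^ N) (j / 2 ^ (N + e)) le_rfl b4 b1 (b3.trans b2)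
    have q2 := hk (j / 2 ^ (N + e)) ((j + 1) / 2 ^ (N + e)) b1 (b3.trans b2) (b1.trans b3) b2
    have s1 : realExt f (j / 2 ^ (N + e)) = ((c * 2 ^ q + (j - i * 2 ^ e) : ℤ) : ℝ)
        / 2 ^ (q + M) := by
      have : (2 : ℝ) ^ k * (j / 2 ^ (N + e) - i / 2 ^ N) = (j - i * 2 ^ e) / 2 ^ (q + M) := by
        rw [hz, pow_add]; field_simp
      have h2 : (c : ℝ) / 2 ^ M = c * 2 ^ q / 2 ^ (q + M) := by rw [pow_add]; field_simp
      push_cast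
      rw [add_div, ← this, ← h2, ← hc]
      linarith
    refine ⟨c * 2 ^ q + (j - i * 2 ^ e), q + M, s1, ?_⟩
    have : (2 : ℝ) ^ k * ((j + 1) / 2 ^ (N + e) - j / 2 ^ (N + e)) = 1 / 2 ^ (q + M) := by
      rw [hz]; field_simp; ring
    have s2 := add_div ((c * 2 ^ q + (j - i * 2 ^ e) : ℤ) : ℝ) 1 (2 ^ (q + M))
    rw [← this, ← s1] at s2
    linarith

theorem IsDyadic.eventually_eq {x : ℝ} (h : IsDyadic x) :
    ∀ᶠ N : ℕ in atTop, ∃ i : ℤ, x = i / 2 ^ N := by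
  obtain ⟨a, n, rfl⟩ := h
  filter_upwards [eventually_ge_atTop n] with N hN
  obtain ⟨e, rfl⟩ := Nat.exists_eq_add_of_le hN
  refine ⟨a * 2 ^ e, ?_⟩
  rw [pow_add]; push_cast; field_simp

theorem exists_common_denominator (B : Finset unitInterval) (hB : ∀ b ∈ B, IsDyadic b) :
    ∃ N : ℕ, ∀ b ∈ B, ∃ i : ℤ, (b : ℝ) = i / 2 ^ N := by
  exact ((eventually_all_finset B).2 fun b hb => (hB b hb).eventually_eq).exists

/-- A uniform subdivision, fine enough for all affine pieces at once, has standard image intervals;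
these partition [0, 1] and hence come from a tree as well. -/
theorem exists_matches_leaves (f : thompsonF) :
    ∃ T R : BinTree, Matches f.1 (T.leaves 0 1) (R.leaves 0 1) := by
  obtain ⟨hmono, hpl⟩ := f.2
  have hpl' := hpl
  obtain ⟨B, hB, hf⟩ := hpl
  obtain ⟨N, hN⟩ := exists_common_denominator B hB
  have local_affine : ∀ i : ℕ, i ∈ Finset.range (2 ^ N) →
      ∀ᶠ P : ℕ in atTop, N ≤ P ∧ ∀ j : ℕ, i * 2 ^ (P - N) ≤ j → j < (i + 1) * 2 ^ (P - N) →
      AffOn f.1 (j / 2 ^ P) ((j + 1) / 2 ^ P) (realExt f.1 (j / 2 ^ P))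
        (realExt f.1 ((j + 1) / 2 ^ P)) ∧
      IsStd (realExt f.1 (j / 2 ^ P)) (realExt f.1 ((j + 1) / 2 ^ P)) := by
    intro i hi
    have hi : i + 1 ≤ 2 ^ N := Finset.mem_range.1 hi
    have hir : (i : ℝ) + 1 ≤ 2 ^ N := by exact_mod_cast hi
    have h0 : (0 : ℝ) ≤ i / 2 ^ N := by positivity
    have h1 : (i : ℝ) / 2 ^ N < (i + 1) / 2 ^ N := by gcongr; linarith
    have h2 : ((i : ℝ) + 1) / 2 ^ N ≤ 1 := by rw [div_le_one (by positivity)]; exact hir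
    obtain ⟨k, hk⟩ := hf ⟨i / 2 ^ N, h0, by linarith⟩ ⟨(i + 1) / 2 ^ N, by linarith, h2⟩ h1 (by
      rintro b hb ⟨l1, l2⟩
      obtain ⟨q, hq⟩ := hN b hb
      have l1' : (i : ℝ) / 2 ^ N < b := l1
      have l2' : (b : ℝ) < (i + 1) / 2 ^ N := l2
      rw [hq, div_lt_div_iff_of_pos_right (by positivity)] at l1' l2'
      have l1'' : (i : ℤ) < q := by exact_mod_cast l1'
      have l2'' : q < (i : ℤ) + 1 := by exact_mod_cast l2'
      omega)
    refine eventually_affOn_isStd (k := k) ?_ ?_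
    · have := hpl'.map_dyadic hmono ⟨i / 2 ^ N, h0, by linarith⟩ ⟨i, N, by simp⟩
      rwa [← realExt_coe] at this
    · intro s t hs hs' ht ht'
      have := hk ⟨s, by linarith, by linarith⟩ ⟨hs, hs'⟩ ⟨t, by linarith, by linarith⟩ ⟨ht, ht'⟩
      simpa only [← realExt_coe] using this
  obtain ⟨P, hP⟩ := ((eventually_all_finset _).2 local_affine).exists
  have hNP : N ≤ P := (hP 0 (Finset.mem_range.2 (by positivity))).1
  obtain ⟨T, Q, h1, h2, h3⟩ := splits_zero_one (f := f.1) P fun j hj => by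
    have hpos : 0 < 2 ^ (P - N) := by positivity
    have hlt : j / 2 ^ (P - N) < 2 ^ N := by
      rw [Nat.div_lt_iff_lt_mul hpos, ← pow_add, Nat.add_sub_cancel' hNP]; exact hj
    obtain ⟨q1, q2⟩ := (hP _ (Finset.mem_range.2 hlt)).2 j (Nat.div_mul_le_self _ _)
      (by rw [mul_comm]; exact Nat.lt_mul_div_succ j hpos)
    exact q1.splits q2
  have e0 : realExt f.1 0 = 0 := by
    have := realExt_coe f.1 0
    rwa [hmono.map_zero_unitInterval] at this
  have e1 : realExt f.1 1 = 1 := by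
    have h := realExt_coe f.1 1
    have : f.1 1 = 1 := by
      refine le_antisymm unitInterval.le_one' ?_
      have := hmono.monotone (unitInterval.le_one' : f.1.symm 1 ≤ 1)
      simpa using this
    rwa [this] at h
  rw [e0, e1] at h2
  obtain ⟨R, rfl⟩ := h2.exists_leaves ⟨0, 0, by norm_num, by norm_num⟩ h3
  exact ⟨T, R, h1⟩

/-- Thompson's group `F` is generated by `x₀` and `x₁`. -/
theorem closure_x0_x1 : Subgroup.closure {x0, x1} = ⊤ := by
  refine (Subgroup.eq_top_iff' _).2 fun f => ?_
  obtain ⟨T, R, h⟩ := exists_matches_leaves f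
  exact mem_closure_of_matches h

/-! ### Elements of `F` with small support -/

/-- A copy of `x₀⁻¹` on the interval `[s, s + 4 d]`. -/
noncomputable def bumpFun (s d t : ℝ) : ℝ :=
  if t ≤ s then t else if t ≤ s + d then 2 * t - s else if t ≤ s + 2 * d then t + d
    else if t ≤ s + 4 * d then (t + s + 4 * d) / 2 else t

/-- The inverse of `bumpFun`. -/
noncomputable def bumpInv (s d t : ℝ) : ℝ :=
  if t ≤ s then t else if t ≤ s + 2 * d then (t + s) / 2 else if t ≤ s + 3 * d then t - d
    else if t ≤ s + 4 * d then 2 * t - s - 4 * d else t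

/-- `bumpFun` as a homeomorphism of `[0, 1]`. -/
noncomputable def bumpHomeo (s d : ℝ) (hd : 0 < d) (hs : 0 ≤ s) (hsd : s + 4 * d ≤ 1) :
    unitInterval ≃ₜ unitInterval :=
  homeoOfMonotone (bumpFun s d) (bumpInv s d)
    (by rintro t ⟨h0, h1⟩; unfold bumpFun; split_ifs <;> constructor <;> linarith)
    (by rintro t ⟨h0, h1⟩; unfold bumpInv; split_ifs <;> constructor <;> linarith)
    (by intro t; unfold bumpFun bumpInv; split_ifs <;> linarith)
    (by intro t; unfold bumpFun bumpInv; split_ifs <;> linarith)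
    (by intro s t h; unfold bumpFun; split_ifs <;> linarith)
    (by intro s t h; unfold bumpInv; split_ifs <;> linarith)

theorem bumpHomeo_mem {s d : ℝ} (hd : 0 < d) (hs : 0 ≤ s) (hsd : s + 4 * d ≤ 1)
    (ds : IsDyadic s) (dd : IsDyadic d) : bumpHomeo s d hd hs hsd ∈ thompsonF := by
  classical
  have d1 := ds.add dd
  have d2 := d1.add dd
  have d4 := (d2.add dd).add dd
  refine ⟨strictMono_homeoOfMonotone _ _ _ _ _ _ _ _,
    {⟨s, by linarith, by linarith⟩, ⟨s + d, by linarith, by linarith⟩,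
      ⟨s + d + d, by linarith, by linarith⟩, ⟨s + d + d + d + d, by linarith, by linarith⟩}, ?_, ?_⟩
  · intro b hb
    simp only [Finset.mem_insert, Finset.mem_singleton] at hb
    rcases hb with rfl | rfl | rfl | rfl <;> assumption
  · intro a b hab hB
    have h1 := hB _ (Finset.mem_insert_self _ _)
    have h2 := hB _ (Finset.mem_insert_of_mem (Finset.mem_insert_self _ _))
    have h3 := hB _ (Finset.mem_insert_of_mem (Finset.mem_insert_of_mem
      (Finset.mem_insert_self _ _)))
    have h4 := hB _ (Finset.mem_insert_of_mem (Finset.mem_insert_of_mem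
      (Finset.mem_insert_of_mem (Finset.mem_singleton_self _))))
    simp only [← Subtype.coe_lt_coe, not_and, not_lt] at h1 h2 h3 h4 hab
    have key : ∀ k : ℤ, (∀ x ∈ Set.Icc (a : ℝ) b, ∀ t ∈ Set.Icc (a : ℝ) b,
        bumpFun s d t - bumpFun s d x = (2 : ℝ) ^ k * (t - x)) → ∃ k : ℤ, ∀ x ∈ Set.Icc a b,
        ∀ t ∈ Set.Icc a b, (bumpHomeo s d hd hs hsd t : ℝ) - bumpHomeo s d hd hs hsd x
          = (2 : ℝ) ^ k * ((t : ℝ) - x) :=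
      fun k hk => ⟨k, fun x hx t ht => hk x hx t ht⟩
    rcases le_or_gt s (a : ℝ) with ha | ha
    · have i1 : s ≤ a := ha
      rcases le_or_gt (s + d) (a : ℝ) with ha | ha
      · rcases le_or_gt (s + d + d) (a : ℝ) with ha | ha
        · rcases le_or_gt (s + d + d + d + d) (a : ℝ) with ha | ha
          · refine key 0 ?_
            rintro x ⟨hx, hx'⟩ t ⟨ht, ht'⟩
            unfold bumpFun
            split_ifs <;> norm_num <;> linarith
          · have hb := h4 ha
            refine key (-1) ?_
            rintro x ⟨hx, hx'⟩ t ⟨ht, ht'⟩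
            unfold bumpFun
            split_ifs <;> norm_num <;> linarith
        · have hb := h3 ha
          refine key 0 ?_
          rintro x ⟨hx, hx'⟩ t ⟨ht, ht'⟩
          unfold bumpFun
          split_ifs <;> norm_num <;> linarith
      · have hb := h2 ha
        refine key 1 ?_
        rintro x ⟨hx, hx'⟩ t ⟨ht, ht'⟩
        unfold bumpFun
        split_ifs <;> norm_num <;> linarith
    · have hb := h1 ha
      refine key 0 ?_
      rintro x ⟨hx, hx'⟩ t ⟨ht, ht'⟩
      unfold bumpFun
      split_ifs <;> norm_num <;> linarith

theorem exists_bump {s d : ℝ} (hd : 0 < d) (hs : 0 ≤ s) (hsd : s + 4 * d ≤ 1)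
    (ds : IsDyadic s) (dd : IsDyadic d) : ∃ f : thompsonF,
      (∀ t : unitInterval, (t : ℝ) = s + d → (f.1 t : ℝ) = s + 2 * d) ∧
      ∀ t : unitInterval, (t : ℝ) ≤ s ∨ s + 4 * d ≤ t → f.1 t = t := by
  refine ⟨⟨_, bumpHomeo_mem hd hs hsd ds dd⟩, ?_, ?_⟩
  · intro t ht
    change bumpFun s d t = _
    rw [ht]; unfold bumpFun
    split_ifs <;> linarith
  · intro t ht
    refine Subtype.ext ?_
    change bumpFun s d t = _
    unfold bumpFun
    rcases ht with ht | ht <;> split_ifs <;> linarith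

/-- A composite of e bumps, each advancing the point by one cell. A bump at p is supported between
one cell below p and three cells above, whence the margins of one cell below the path and two above.
-/
theorem exists_translating {n : ℕ} {i : ℤ} (e : ℕ) (hi : 1 ≤ i)
    (he : ((i : ℝ) + e + 2) / 2 ^ n ≤ 1) : ∃ f : thompsonF,
      (∀ t : unitInterval, (t : ℝ) = i / 2 ^ n → (f.1 t : ℝ) = (i + e) / 2 ^ n) ∧
      ∀ t : unitInterval, (t : ℝ) ≤ (i - 1) / 2 ^ n ∨ (i + e + 2) / 2 ^ n ≤ (t : ℝ) →
        f.1 t = t := by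
  induction e with
  | zero => exact ⟨1, fun t ht => by simpa using ht, fun _ _ => rfl⟩
  | succ e ih =>
    have hp : (0 : ℝ) < 2 ^ n := by positivity
    have hir : (1 : ℝ) ≤ i := by exact_mod_cast hi
    have hle : ((i : ℝ) + e + 2) / 2 ^ n ≤ (i + (e + 1 : ℕ) + 2) / 2 ^ n := by
      push_cast; gcongr ?_ / _; linarith
    obtain ⟨f, f1, f2⟩ := ih (hle.trans he)
    have hs4 : ((i : ℝ) + e - 1) / 2 ^ n + 4 * (1 / 2 ^ n) = (i + (e + 1 : ℕ) + 2) / 2 ^ n := by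
      push_cast; field_simp; ring
    obtain ⟨g, g1, g2⟩ := exists_bump (s := (i + e - 1) / 2 ^ n) (d := 1 / 2 ^ n) (by positivity)
      (by apply div_nonneg _ hp.le; have : (0 : ℝ) ≤ e := by positivity
          linarith) (by rw [hs4]; exact he)
      ⟨i + e - 1, n, by push_cast; ring⟩ ⟨1, n, by push_cast; ring⟩
    rw [hs4] at g2
    refine ⟨g * f, fun t ht => ?_, fun t ht => ?_⟩
    · change ((g.1 (f.1 t) : unitInterval) : ℝ) = _
      rw [g1 _ (by rw [f1 t ht]; field_simp; ring)]
      push_cast; field_simp; ring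
    · change g.1 (f.1 t) = t
      rcases ht with ht | ht
      · rw [f2 t (.inl ht), g2 t (.inl (ht.trans ?_))]
        have : (0 : ℝ) ≤ e := by positivity
        gcongr ?_ / _; linarith
      · rw [f2 t (.inr (hle.trans ht)), g2 t (.inr ht)]

theorem exists_moving_up {p q : unitInterval} {α β : ℝ} (dp : IsDyadic p) (dq : IsDyadic q)
    (hα : 0 ≤ α) (hβ : β ≤ 1) (h1 : α < p) (h2 : p ≤ q) (h3 : (q : ℝ) < β) :
    ∃ f : thompsonF, f.1 p = q ∧ ∀ t : unitInterval, (t : ℝ) ≤ α ∨ β ≤ t → f.1 t = t := by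
  have hlim : Tendsto (fun n : ℕ => 2 * (1 / 2 : ℝ) ^ n) atTop (𝓝 0) := by
    simpa using (tendsto_pow_atTop_nhds_zero_of_lt_one (r := (1 / 2 : ℝ)) (by norm_num)
      (by norm_num)).const_mul 2
  -- The translation from p to q reaches one cell below p and two cells above q.
  have ev : ∀ᶠ n : ℕ in atTop, 2 * (1 / 2 : ℝ) ^ n < min (p - α) (β - q) :=
    hlim.eventually_lt_const (lt_min (by linarith) (by linarith))
  obtain ⟨n, hn, ⟨i, hi⟩, j, hj⟩ := (ev.and (dp.eventually_eq.and dq.eventually_eq)).exists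
  rw [lt_min_iff] at hn
  obtain ⟨n1, n2⟩ := hn
  have hpos : (0 : ℝ) < 1 / 2 ^ n := by positivity
  rw [one_div_pow] at n1 n2
  have hpr : (0 : ℝ) < i / 2 ^ n := by rw [← hi]; linarith
  have hi1 : 1 ≤ i := by
    have : (0 : ℝ) < i := by
      by_contra hc
      exact absurd hpr (not_lt.2 (div_nonpos_of_nonpos_of_nonneg (not_lt.1 hc) (by positivity)))
    have : 0 < i := by exact_mod_cast this
    omega
  have hij : i ≤ j := by
    have : (p : ℝ) ≤ q := h2
    rw [hi, hj, div_le_div_iff_of_pos_right (by positivity)] at this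
    exact_mod_cast this
  obtain ⟨e, rfl⟩ := Int.le.dest hij
  push_cast at hj
  have e2 : ((i : ℝ) + e + 2) / 2 ^ n = q + 2 * (1 / 2 ^ n) := by rw [hj]; ring
  have e1 : ((i : ℝ) - 1) / 2 ^ n = p - 1 / 2 ^ n := by rw [hi]; ring
  obtain ⟨f, f1, f2⟩ := exists_translating (n := n) e hi1 (by rw [e2]; linarith)
  refine ⟨f, Subtype.ext ((f1 p hi).trans hj.symm), fun t ht => f2 t ?_⟩
  rw [e1, e2]
  rcases ht with ht | ht
  · left; linarith
  · right; linarith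

theorem exists_moving {p q : unitInterval} {α β : ℝ} (dp : IsDyadic p) (dq : IsDyadic q)
    (hα : 0 ≤ α) (hβ : β ≤ 1) (hp : α < p) (hp' : (p : ℝ) < β) (hq : α < q) (hq' : (q : ℝ) < β) :
    ∃ f : thompsonF, f.1 p = q ∧ ∀ t : unitInterval, (t : ℝ) ≤ α ∨ β ≤ t → f.1 t = t := by
  rcases le_total p q with h | h
  · exact exists_moving_up dp dq hα hβ hp h hq'
  · obtain ⟨f, f1, f2⟩ := exists_moving_up dq dp hα hβ hq h hp'
    refine ⟨f⁻¹, ?_, fun t ht => ?_⟩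
    · rw [← f1]; exact f.1.symm_apply_apply q
    · conv_lhs => rw [← f2 t ht]
      exact f.1.symm_apply_apply t

/-- A finite strictly increasing partial map between dyadic points of `(0, β)` extends to an
element of `F` that fixes `[β, 1]`. -/
theorem exists_interpolating (A : Finset (unitInterval × unitInterval)) {β : ℝ} (hβ : β ≤ 1)
    (hd : ∀ p ∈ A, IsDyadic p.1 ∧ IsDyadic p.2)
    (h1 : ∀ p ∈ A, 0 < (p.1 : ℝ) ∧ (p.1 : ℝ) < β) (h2 : ∀ p ∈ A, 0 < (p.2 : ℝ) ∧ (p.2 : ℝ) < β)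
    (hA : ∀ p ∈ A, ∀ q ∈ A, p.1 < q.1 ↔ p.2 < q.2) :
    ∃ f : thompsonF, (∀ p ∈ A, f.1 p.1 = p.2) ∧ ∀ t : unitInterval, β ≤ t → f.1 t = t := by
  classical
  generalize hn : A.card = n
  induction n using Nat.strong_induction_on generalizing A β with
  | _ n ih =>
    rcases A.eq_empty_or_nonempty with rfl | hne
    · exact ⟨1, by simp, fun _ _ => rfl⟩
    obtain ⟨m, hm, hmax⟩ := A.exists_max_image Prod.fst hne
    -- The largest source is sent to its target first. The other sources then lie below `m.2`, as do
    -- their targets, so the induction supplies a map that fixes `[m.2, 1]` and keeps what was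
    -- achieved.
    obtain ⟨f, f1, f2⟩ := exists_moving (hd m hm).1 (hd m hm).2 le_rfl hβ (h1 m hm).1 (h1 m hm).2
      (h2 m hm).1 (h2 m hm).2
    have hf0 := f.2.1.map_zero_unitInterval
    have hlt : ∀ p ∈ A.erase m, p.1 < m.1 := by
      intro p hp
      obtain ⟨hpm, hp⟩ := Finset.mem_erase.1 hp
      refine lt_of_le_of_ne (hmax p hp) fun he => hpm (Prod.ext he ?_)
      refine le_antisymm (not_lt.1 fun h => ?_) (not_lt.1 fun h => ?_)
      · exact (((hA m hm p hp).2 h).ne' he)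
      · exact (((hA p hp m hm).2 h).ne he)
    set A' := (A.erase m).image fun p => (f.1 p.1, p.2) with hA'
    have mem : ∀ p' ∈ A', ∃ p ∈ A.erase m, p' = (f.1 p.1, p.2) := by
      intro p' hp'
      obtain ⟨p, hp, rfl⟩ := Finset.mem_image.1 hp'
      exact ⟨p, hp, rfl⟩
    have hcard : A'.card < n := by
      refine Finset.card_image_le.trans_lt ?_
      rw [← hn]
      exact Finset.card_erase_lt_of_mem hm
    obtain ⟨g, g1, g2⟩ := ih A'.card hcard A' (β := (m.2 : ℝ)) m.2.2.2
      (by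
        intro p' hp'
        obtain ⟨p, hp, rfl⟩ := mem p' hp'
        have hp := Finset.mem_of_mem_erase hp
        exact ⟨f.2.2.map_dyadic f.2.1 _ (hd p hp).1, (hd p hp).2⟩)
      (by
        intro p' hp'
        obtain ⟨p, hp, rfl⟩ := mem p' hp'
        refine ⟨?_, ?_⟩
        · have hpos : 0 < p.1 := (h1 p (Finset.mem_of_mem_erase hp)).1
          have := f.2.1 hpos
          rw [hf0] at this
          exact this
        · have := f.2.1 (hlt p hp)
          rw [f1] at this
          exact this)
      (by
        intro p' hp'
        obtain ⟨p, hp, rfl⟩ := mem p' hp'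
        have hp' := Finset.mem_of_mem_erase hp
        exact ⟨(h2 p hp').1, (hA p hp' m hm).1 (hlt p hp)⟩)
      (by
        intro p' hp' q' hq'
        obtain ⟨p, hp, rfl⟩ := mem p' hp'
        obtain ⟨q, hq, rfl⟩ := mem q' hq'
        rw [f.2.1.lt_iff_lt]
        exact hA p (Finset.mem_of_mem_erase hp) q (Finset.mem_of_mem_erase hq)) rfl
    refine ⟨g * f, fun p hp => ?_, fun t ht => ?_⟩
    · change g.1 (f.1 p.1) = p.2
      by_cases hpm : p = m
      · subst hpm
        rw [f1]; exact g2 _ le_rfl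
      · exact g1 (f.1 p.1, p.2) (Finset.mem_image.2 ⟨p, Finset.mem_erase.2 ⟨hpm, hp⟩, rfl⟩)
    · change g.1 (f.1 t) = t
      rw [f2 t (.inr ht), g2 t ((h2 m hm).2.le.trans ht)]

/-! ### Trajectories of reduced words -/

section Words

variable {ι : Type*}

/-- Minus the exponent sum of the letter `none`. -/
def scale : List (Option ι × Bool) → ℤ
  | [] => 0
  | (none, true) :: L => scale L - 1
  | (none, false) :: L => scale L + 1
  | (some _, _) :: L => scale L

/-- The number of letters other than `none`. -/
def steps : List (Option ι × Bool) → ℕ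
  | [] => 0
  | (none, _) :: L => steps L
  | (some _, _) :: L => steps L + 1

theorem scale_bounds (L : List (Option ι × Bool)) :
    -(L.length : ℤ) ≤ scale L ∧ scale L ≤ L.length := by
  induction L with
  | nil => simp [scale]
  | cons s L ih =>
    obtain ⟨_ | i, _ | _⟩ := s <;> simp only [scale, List.length_cons] <;> push_cast <;> omega

theorem steps_le (L : List (Option ι × Bool)) : steps L ≤ L.length := by
  induction L with
  | nil => simp [steps]
  | cons s L ih => obtain ⟨_ | i, b⟩ := s <;> simp only [steps, List.length_cons] <;> omega

theorem scale_append (L M : List (Option ι × Bool)) : scale (L ++ M) = scale L + scale M := by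
  induction L with
  | nil => simp [scale]
  | cons s L ih =>
    obtain ⟨_ | i, _ | _⟩ := s <;> simp only [scale, List.cons_append, ih] <;> ring

theorem steps_append (L M : List (Option ι × Bool)) : steps (L ++ M) = steps L + steps M := by
  induction L with
  | nil => simp [steps]
  | cons s L ih =>
    obtain ⟨_ | i, b⟩ := s <;> simp only [steps, List.cons_append, ih]; ring

theorem steps_le_of_suffix {L M : List (Option ι × Bool)} (h : L <:+ M) : steps L ≤ steps M := by
  obtain ⟨A, rfl⟩ := h
  rw [steps_append]; omega

/-- A reduced word in a single letter is a power of it, so its exponents cannot cancel. -/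
theorem scale_of_steps_eq_zero {b : Bool} {L : List (Option ι × Bool)}
    (hr : FreeGroup.IsReduced ((none, b) :: L)) (hs : steps L = 0) :
    scale ((none, b) :: L) = (if b then -1 else 1) * (L.length + 1) := by
  induction L generalizing b with
  | nil => cases b <;> simp [scale]
  | cons s L ih =>
    obtain ⟨_ | i, b'⟩ := s
    · rw [FreeGroup.isReduced_cons_cons] at hr
      obtain rfl : b = b' := hr.1 rfl
      have := ih hr.2 hs
      cases b <;> simp only [scale] at this ⊢ <;> rw [this] <;> push_cast <;> simp; ring
    · simp [steps] at hs

/-- It serves twice: for the letters between two conflicting demands, and for a trajectory that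
returns to its start. -/
theorem eq_nil_of_scale_steps {L : List (Option ι × Bool)} (hr : FreeGroup.IsReduced L)
    (hs : steps L = 0) (ht : scale L = 0) : L = [] := by
  cases L with
  | nil => rfl
  | cons s L =>
    obtain ⟨_ | i, b⟩ := s
    · rw [scale_of_steps_eq_zero hr hs] at ht
      have : (L.length : ℤ) + 1 ≠ 0 := by positivity
      cases b <;> simp at ht <;> omega
    · simp [steps] at hs

/-- Two steps by the same letter at the same scale, at equal or consecutive times, go in the same
direction. -/
theorem same_sign {w L L' : List (Option ι × Bool)} {i : ι} {b b' : Bool}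
    (hw : FreeGroup.IsReduced w) (h : (some i, b) :: L <:+ w) (h' : (some i, b') :: L' <:+ w)
    (ht : scale L = scale L') (hs : steps L' = steps L ∨ steps L' = steps L + 1) : b = b' := by
  have fin : (some i, b) :: L = (some i, b') :: L' → b = b' := by
    intro e
    simp only [List.cons.injEq, Prod.mk.injEq, true_and] at e
    exact e.1
  rcases List.suffix_or_suffix_of_suffix h h' with h1 | h1
  · rcases List.suffix_cons_iff.1 h1 with h2 | h2
    · exact fin h2
    · obtain ⟨A, hA⟩ := h2
      have s1 : steps L' = steps A + (steps L + 1) := by rw [← hA, steps_append]; rfl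
      have s2 : scale L' = scale A + scale L := by rw [← hA, scale_append]; rfl
      have hr : FreeGroup.IsReduced ((some i, b') :: (A ++ (some i, b) :: L)) := by
        rw [hA]; exact hw.infix h'.isInfix
      -- The word A between the two occurrences has no steps and scale zero. Once it is empty, the
      -- two letters are adjacent in a reduced word.
      have hA' : A = [] := by
        refine eq_nil_of_scale_steps (hr.infix ⟨[(some i, b')], (some i, b) :: L, by simp⟩)
          (by omega) (by omega)
      subst hA'
      rw [List.nil_append, FreeGroup.isReduced_cons_cons] at hr
      exact (hr.1 rfl).symm
  · rcases List.suffix_cons_iff.1 h1 with h2 | h2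
    · exact fin h2.symm
    · have := steps_le_of_suffix h2
      simp only [steps] at this
      omega

end Words

/-! ### A grid of dyadic points near 0, and words acting on it -/

/-- The point with scale `τ` and position `e` on that scale. -/
noncomputable def gridPt (K r : ℕ) (τ : ℤ) (e : ℕ) : ℝ :=
  (1 / 2) ^ K * 2 ^ τ * (1 + e / 2 ^ r)

theorem gridPt_pos (K r : ℕ) (τ : ℤ) (e : ℕ) : 0 < gridPt K r τ e := by
  unfold gridPt; positivity

theorem gridPt_lt_top {K r : ℕ} {τ σ : ℤ} {e : ℕ} (he : e < 2 ^ r) (h : τ < σ) :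
    gridPt K r τ e < (1 / 2) ^ K * 2 ^ σ := by
  have h1 : (e : ℝ) / 2 ^ r < 1 := by
    rw [div_lt_one (by positivity)]; exact_mod_cast he
  have h2 : (2 : ℝ) ^ τ * 2 ≤ 2 ^ σ := by
    rw [← zpow_add_one₀ two_ne_zero]
    exact zpow_le_zpow_right₀ one_le_two (by omega)
  have hp : (0 : ℝ) < 2 ^ τ := by positivity
  unfold gridPt
  rw [mul_assoc]
  refine mul_lt_mul_of_pos_left ?_ (by positivity)
  nlinarith

/-- The factor 1 + e / 2ʳ lies in [1, 2), so the scales occupy disjoint ranges and the order is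
lexicographic. -/
theorem gridPt_lt_iff {K r : ℕ} {τ σ : ℤ} {e e' : ℕ} (he : e < 2 ^ r) (he' : e' < 2 ^ r) :
    gridPt K r τ e < gridPt K r σ e' ↔ τ < σ ∨ τ = σ ∧ e < e' := by
  have key : ∀ {τ σ : ℤ} {e e' : ℕ}, e < 2 ^ r → e' < 2 ^ r → τ < σ →
      gridPt K r τ e < gridPt K r σ e' := by
    intro τ σ e e' he _ h
    refine (gridPt_lt_top he h).trans_le ?_
    unfold gridPt
    refine le_mul_of_one_le_right (by positivity) ?_
    have : (0 : ℝ) ≤ e' / 2 ^ r := by positivity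
    linarith
  rcases lt_trichotomy τ σ with h | rfl | h
  · simp [key he he' h, h]
  · have hp : (0 : ℝ) < (1 / 2) ^ K * 2 ^ τ := by positivity
    unfold gridPt
    rw [mul_lt_mul_iff_right₀ hp, add_lt_add_iff_left, div_lt_div_iff_of_pos_right (by positivity)]
    simp
  · have := key he' he h
    constructor
    · intro h'; exact absurd h' this.le.not_gt
    · rintro (h' | h') <;> omega

theorem gridPt_inj {K r : ℕ} {τ σ : ℤ} {e e' : ℕ} (he : e < 2 ^ r) (he' : e' < 2 ^ r)
    (h : gridPt K r τ e = gridPt K r σ e') : τ = σ ∧ e = e' := by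
  have h1 := (gridPt_lt_iff (K := K) (τ := τ) (σ := σ) he he').not.1 h.not_lt
  have h2 := (gridPt_lt_iff (K := K) (τ := σ) (σ := τ) he' he).not.1 h.not_gt
  omega

theorem isDyadic_gridPt (K r : ℕ) (τ : ℤ) (e : ℕ) : IsDyadic (gridPt K r τ e) := by
  have h : IsDyadic ((1 / 2) ^ K * (1 + (e : ℝ) / 2 ^ r)) := by
    refine ⟨2 ^ r + e, K + r, ?_⟩
    rw [pow_add, one_div_pow]; push_cast; field_simp
  have := h.zpow_mul τ
  convert this using 1
  unfold gridPt; ring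

theorem gridPt_sub_one (K r : ℕ) (τ : ℤ) (e : ℕ) :
    gridPt K r (τ - 1) e = gridPt K r τ e / 2 := by
  unfold gridPt; rw [zpow_sub_one₀ two_ne_zero]; ring

theorem gridPt_add_one (K r : ℕ) (τ : ℤ) (e : ℕ) :
    gridPt K r (τ + 1) e = 2 * gridPt K r τ e := by
  unfold gridPt; rw [zpow_add_one₀ two_ne_zero]; ring

/-- The value of a word at the given letters. -/
def evalWord {α G : Type*} [Group G] (g : α → G) (L : List (α × Bool)) : G :=
  FreeGroup.lift g (FreeGroup.mk L)

theorem evalWord_nil {α G : Type*} [Group G] (g : α → G) : evalWord g [] = 1 := by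
  simp [evalWord, FreeGroup.lift_mk]

theorem evalWord_cons_true {α G : Type*} [Group G] (g : α → G) (a : α) (L : List (α × Bool)) :
    evalWord g ((a, true) :: L) = g a * evalWord g L := by
  simp [evalWord, FreeGroup.lift_mk]

theorem evalWord_cons_false {α G : Type*} [Group G] (g : α → G) (a : α) (L : List (α × Bool)) :
    evalWord g ((a, false) :: L) = (g a)⁻¹ * evalWord g L := by
  simp [evalWord, FreeGroup.lift_mk]

theorem x0_apply_of_le {t : unitInterval} (h : (t : ℝ) ≤ 1 / 2) : (x0.1 t : ℝ) = t / 2 := by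
  rw [x0_apply]; unfold x0Fun; rw [if_pos h]

theorem x0_inv_apply_of_le {t : unitInterval} (h : (t : ℝ) ≤ 1 / 4) :
    ((x0⁻¹ : thompsonF).1 t : ℝ) = 2 * t := by
  rw [x0_inv_apply]; unfold x0Inv; rw [if_pos h]

theorem supportF_subset {f : thompsonF} {β ε : ℝ} (hβ : β < ε)
    (h : ∀ t : unitInterval, β ≤ t → f.1 t = t) : supportF f ⊆ {t | (t : ℝ) < ε} := by
  have hc : IsClosed {t : unitInterval | (t : ℝ) ≤ β} :=
    isClosed_le continuous_subtype_val continuous_const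
  refine (closure_minimal (fun t ht => ?_) hc).trans fun t ht => lt_of_le_of_lt ht hβ
  exact (not_le.1 fun h' => ht (h t h')).le

/-! ### Elements near 0 without short relations -/

/-- There are elements of `F` with support near `0` such that, together with `x₀`, they satisfy no
short relation near `0`. -/
theorem exists_no_short_relation {ι : Type*} [Finite ι] [DecidableEq ι] (N : ℕ) {ε : ℝ} (hε : 0 < ε) :
    ∃ u : ι → thompsonF, (∀ i, supportF (u i) ⊆ {t | (t : ℝ) < ε}) ∧
      ∀ w : FreeGroup (Option ι), w ≠ 1 → w.norm ≤ N → ∃ t : unitInterval,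
        0 < (t : ℝ) ∧ (t : ℝ) < ε ∧
        (FreeGroup.lift (fun o : Option ι => o.elim x0 u) w).1 t ≠ t := by
  classical
  obtain ⟨code, hcode⟩ := exists_injective_nat (List (Option ι × Bool))
  have hfin : {L : List (Option ι × Bool) | L.length ≤ N}.Finite := List.finite_length_le _ N
  obtain ⟨C, hC⟩ : ∃ C, ∀ L : List (Option ι × Bool), L.length ≤ N → code L ≤ C := by
    obtain ⟨C, hC⟩ := (hfin.image code).bddAbove
    exact ⟨C, fun L hL => hC ⟨L, hL, rfl⟩⟩
  obtain ⟨r, hr⟩ : ∃ r : ℕ, (N + 2) * C + N < 2 ^ r := ⟨_, Nat.lt_two_pow_self⟩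
  -- Below 1/4 both x₀ and its inverse are linear; the strict inequality β < ε absorbs the closure
  -- in the support.
  set β : ℝ := min ε (1 / 2) / 2 with hβ
  have hβ0 : 0 < β := by positivity
  have hβε : β < ε := by
    have := min_le_left ε (1 / 2)
    have : 0 < min ε (1 / 2) := by positivity
    linarith
  have hβ4 : β ≤ 1 / 4 := by
    have := min_le_right ε (1 / 2)
    linarith
  -- Scales do not exceed N, and a point of scale τ lies below 2^(τ+1-K).
  obtain ⟨K, hK⟩ : ∃ K : ℕ, (1 / 2 : ℝ) ^ K < β / 2 ^ (N + 1) :=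
    exists_pow_lt_of_lt_one (by positivity) (by norm_num)
  rw [lt_div_iff₀ (by positivity)] at hK
  have small : ∀ {τ : ℤ} {e : ℕ}, e < 2 ^ r → τ ≤ N → gridPt K r τ e < β := by
    intro τ e he hτ
    refine (gridPt_lt_top (σ := (N + 1 : ℕ)) he (by push_cast; omega)).trans ?_
    rw [zpow_natCast]; exact hK
  -- Each word owns a block of N + 2 positions, of which at most N + 1 are used, so arrows of
  -- different words are never adjacent. The choice of r makes room for all blocks on every scale.
  let idx : List (Option ι × Bool) → List (Option ι × Bool) → ℕ := fun w L =>
    (N + 2) * code w + steps L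
  have idx_lt : ∀ {w L : List (Option ι × Bool)}, w.length ≤ N → L <:+ w → idx w L < 2 ^ r := by
    intro w L hw hL
    have h1 := steps_le L
    have h2 := hL.length_le
    have h3 := Nat.mul_le_mul_left (N + 2) (hC w hw)
    simp only [idx]; omega
  let pt : List (Option ι × Bool) → List (Option ι × Bool) → unitInterval := fun w L =>
    Set.projIcc 0 1 zero_le_one (gridPt K r (scale L) (idx w L))
  have scale_le : ∀ {w L : List (Option ι × Bool)}, w.length ≤ N → L <:+ w → scale L ≤ N := by
    intro w L hw hL
    have h1 := (scale_bounds L).2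
    have h2 := hL.length_le
    omega
  have pt_lt : ∀ {w L : List (Option ι × Bool)}, w.length ≤ N → L <:+ w →
      gridPt K r (scale L) (idx w L) < β := fun hw hL => small (idx_lt hw hL) (scale_le hw hL)
  have pt_coe : ∀ {w L : List (Option ι × Bool)}, w.length ≤ N → L <:+ w →
      (pt w L : ℝ) = gridPt K r (scale L) (idx w L) := by
    intro w L hw hL
    simp only [pt]
    rw [Set.projIcc_of_mem zero_le_one ⟨(gridPt_pos _ _ _ _).le, by linarith [pt_lt hw hL]⟩]
  -- the arrows prescribed for the letter `i`
  let arr : ι → Set (unitInterval × unitInterval) := fun i =>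
    {p | ∃ w L b, w.length ≤ N ∧ FreeGroup.IsReduced w ∧ (some i, b) :: L <:+ w ∧
      p = bif b then (pt w L, pt w ((some i, b) :: L)) else (pt w ((some i, b) :: L), pt w L)}
  have arr_fin : ∀ i, (arr i).Finite := by
    intro i
    refine ((hfin.prod (hfin.prod (Set.finite_univ (α := Bool)))).image fun x =>
      bif x.2.2 then (pt x.1 x.2.1, pt x.1 ((some i, x.2.2) :: x.2.1))
      else (pt x.1 ((some i, x.2.2) :: x.2.1), pt x.1 x.2.1)).subset ?_
    rintro p ⟨w, L, b, hw, -, hL, rfl⟩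
    refine ⟨(w, L, b), ⟨hw, ?_, trivial⟩, rfl⟩
    have := hL.length_le
    simp only [List.length_cons] at this
    exact (by omega : L.length ≤ N)
  -- coordinates of an arrow
  have arr_coord : ∀ i, ∀ p ∈ arr i, ∃ (w L : List (Option ι × Bool)) (b : Bool), w.length ≤ N ∧
      FreeGroup.IsReduced w ∧ (some i, b) :: L <:+ w ∧ idx w L + 1 < 2 ^ r ∧
      (p.1 : ℝ) = gridPt K r (scale L) (idx w L + if b then 0 else 1) ∧
      (p.2 : ℝ) = gridPt K r (scale L) (idx w L + if b then 1 else 0) := by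
    rintro i p ⟨w, L, b, hw, hr, hL, rfl⟩
    have hL' : L <:+ w := (List.suffix_cons _ _).trans hL
    have h1 := pt_coe hw hL
    have h2 := pt_coe hw hL'
    have h3 := idx_lt hw hL
    refine ⟨w, L, b, hw, hr, hL, h3, ?_, ?_⟩ <;> cases b <;> first | exact h1 | exact h2
  have small' : ∀ {w L : List (Option ι × Bool)} {b : Bool} {i : ι} (c : Prop) [Decidable c],
      w.length ≤ N → (some i, b) :: L <:+ w → idx w L + 1 < 2 ^ r →
      ∀ x : unitInterval, (x : ℝ) = gridPt K r (scale L) (idx w L + if c then 0 else 1) →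
      IsDyadic x ∧ 0 < (x : ℝ) ∧ (x : ℝ) < β := by
    intro w L b i c _ hw hL hi x hx
    rw [hx]
    refine ⟨isDyadic_gridPt _ _ _ _, gridPt_pos _ _ _ _, small ?_ ?_⟩
    · split_ifs <;> omega
    · exact scale_le hw ((List.suffix_cons _ _).trans hL)
  have src_ok : ∀ i, ∀ p ∈ arr i, IsDyadic p.1 ∧ 0 < (p.1 : ℝ) ∧ (p.1 : ℝ) < β := by
    intro i p hp
    obtain ⟨w, L, b, hw, -, hL, hi, h1, -⟩ := arr_coord i p hp
    exact small' (b = true) hw hL hi p.1 h1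
  have tgt_ok : ∀ i, ∀ p ∈ arr i, IsDyadic p.2 ∧ 0 < (p.2 : ℝ) ∧ (p.2 : ℝ) < β := by
    intro i p hp
    obtain ⟨w, L, b, hw, -, hL, hi, -, h2⟩ := arr_coord i p hp
    refine small' (¬ b = true) hw hL hi p.2 ?_
    rw [h2]; cases b <;> rfl
  -- Arrows on different scales, or with indices at least two apart, are compatible whatever their
  -- directions. Closer arrows come from the same word and agree in direction by `same_sign`.
  have mono : ∀ i, ∀ p ∈ arr i, ∀ q ∈ arr i, p.1 < q.1 ↔ p.2 < q.2 := by
    intro i p hp q hq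
    obtain ⟨w, L, b, hw, hwr, hL, hi, h1, h2⟩ := arr_coord i p hp
    obtain ⟨w', L', b', hw', hwr', hL', hi', h1', h2'⟩ := arr_coord i q hq
    rw [← Subtype.coe_lt_coe, ← Subtype.coe_lt_coe, h1, h2, h1', h2',
      gridPt_lt_iff (by split_ifs <;> omega) (by split_ifs <;> omega),
      gridPt_lt_iff (by split_ifs <;> omega) (by split_ifs <;> omega)]
    have l1 : steps L + 1 ≤ N := (steps_le _).trans (hL.length_le.trans hw)
    have l1' : steps L' + 1 ≤ N := (steps_le _).trans (hL'.length_le.trans hw')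
    have hsame : scale L = scale L' → (idx w' L' = idx w L ∨ idx w' L' = idx w L + 1 ∨
        idx w L = idx w' L' + 1) → b = b' := by
      intro hsc hidx
      have hcc : code w = code w' := by
        simp only [idx] at hidx
        rcases lt_trichotomy (code w) (code w') with h | h | h
        · have := Nat.mul_le_mul_left (N + 2) (Nat.succ_le_of_lt h)
          rw [Nat.mul_succ] at this; omega
        · exact h
        · have := Nat.mul_le_mul_left (N + 2) (Nat.succ_le_of_lt h)
          rw [Nat.mul_succ] at this; omega
      obtain rfl := hcode hcc
      simp only [idx] at hidx
      rcases hidx with h | h | h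
      · exact same_sign hwr hL hL' hsc (by omega)
      · exact same_sign hwr hL hL' hsc (by omega)
      · exact (same_sign hwr hL' hL hsc.symm (by omega)).symm
    by_cases hsc : scale L = scale L'
    · by_cases hidx : idx w' L' = idx w L ∨ idx w' L' = idx w L + 1 ∨ idx w L = idx w' L' + 1
      · obtain rfl := hsame hsc hidx
        cases b <;> simp
      · cases b <;> cases b' <;> simp [hsc] <;> omega
    · simp [hsc]
  choose u hu1 hu2 using fun i => exists_interpolating (arr_fin i).toFinset (β := β)
    (by linarith)
    (fun p hp => ⟨(src_ok i p ((arr_fin i).mem_toFinset.1 hp)).1,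
      (tgt_ok i p ((arr_fin i).mem_toFinset.1 hp)).1⟩)
    (fun p hp => (src_ok i p ((arr_fin i).mem_toFinset.1 hp)).2)
    (fun p hp => (tgt_ok i p ((arr_fin i).mem_toFinset.1 hp)).2)
    (fun p hp q hq => mono i p ((arr_fin i).mem_toFinset.1 hp) q ((arr_fin i).mem_toFinset.1 hq))
  refine ⟨u, fun i => supportF_subset hβε (hu2 i), fun v hv hvN => ?_⟩
  set w := v.toWord with hw
  have hwN : w.length ≤ N := hvN
  have hwr : FreeGroup.IsReduced w := FreeGroup.isReduced_toWord
  have hw0 : w ≠ [] := fun h => hv (FreeGroup.toWord_eq_nil_iff.1 h)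
  -- The rightmost letter acts first, so the suffixes of w are the stages of the trajectory.
  have traj : ∀ L : List (Option ι × Bool), L <:+ w →
      (evalWord (fun o : Option ι => o.elim x0 u) L).1 (pt w []) = pt w L := by
    intro L hL
    induction L with
    | nil => rw [evalWord_nil]; rfl
    | cons s L ih =>
      have hL' : L <:+ w := (List.suffix_cons _ _).trans hL
      have ih := ih hL'
      have c1 := pt_coe hwN hL
      have c2 := pt_coe hwN hL'
      have c3 := pt_lt hwN hL'
      obtain ⟨_ | i, _ | _⟩ := s
      · rw [evalWord_cons_false]
        change (x0⁻¹ : thompsonF).1 ((evalWord (fun o : Option ι => o.elim x0 u) L).1 _) = _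
        rw [ih]
        refine Subtype.ext ?_
        rw [x0_inv_apply_of_le (by rw [c2]; linarith), c1, c2]
        exact (gridPt_add_one _ _ _ _).symm
      · rw [evalWord_cons_true]
        change x0.1 ((evalWord (fun o : Option ι => o.elim x0 u) L).1 _) = _
        rw [ih]
        refine Subtype.ext ?_
        rw [x0_apply_of_le (by rw [c2]; linarith), c1, c2]
        exact (gridPt_sub_one _ _ _ _).symm
      · rw [evalWord_cons_false]
        change (u i).1.symm ((evalWord (fun o : Option ι => o.elim x0 u) L).1 _) = _
        rw [ih, Homeomorph.symm_apply_eq]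
        exact (hu1 i (pt w ((some i, false) :: L), pt w L) ((arr_fin i).mem_toFinset.2
          ⟨w, L, false, hwN, hwr, hL, rfl⟩)).symm
      · rw [evalWord_cons_true]
        change (u i).1 ((evalWord (fun o : Option ι => o.elim x0 u) L).1 _) = _
        rw [ih]
        exact hu1 i (pt w L, pt w ((some i, true) :: L)) ((arr_fin i).mem_toFinset.2
          ⟨w, L, true, hwN, hwr, hL, rfl⟩)
  have hnil : [] <:+ w := List.nil_suffix
  have c0 := pt_coe hwN hnil
  refine ⟨pt w [], ?_, ?_, fun h => ?_⟩
  · rw [c0]; exact gridPt_pos _ _ _ _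
  · rw [c0]; exact (pt_lt hwN hnil).trans hβε
  · have t := traj w List.suffix_rfl
    rw [evalWord, hw, FreeGroup.mk_toWord, ← hw, h] at t
    have t' := congrArg Subtype.val t
    rw [c0, pt_coe hwN List.suffix_rfl] at t'
    -- Returning to the start means that w has no steps and scale zero.
    obtain ⟨t1, t2⟩ := gridPt_inj (idx_lt hwN hnil) (idx_lt hwN List.suffix_rfl) t'
    simp only [idx, steps, scale] at t1 t2
    exact hw0 (eq_nil_of_scale_steps hwr (by omega) t1.symm)

/-! ### Substituting `aᵐ bᵐ` for a letter -/

section Substitution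

variable {X : Type*}

/-- The letters after the substitution of `aᵐ bᵐ` for the letter `none`. -/
def substLetter (a b : X) (m : ℕ) (o : Option X) : FreeGroup X :=
  o.elim (FreeGroup.of a ^ m * FreeGroup.of b ^ m) FreeGroup.of

/-- The possible leading powers `xᵏ` of the word obtained by substitution from a word of length
at most `n` with first letter `s`. -/
def LeadingPower (a b : X) (m n : ℕ) (s : Option X × Bool) (x : X) (k : ℤ) : Prop :=
  match s with
  | (none, true) => x = a ∧ k = m
  | (none, false) => x = b ∧ k = -m
  | (some z, t) => x = z ∧ ∃ j : ℤ, (if t then 0 < j else j < 0) ∧ |j| ≤ n ∧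
      (k = j ∨ z = a ∧ k = m + j ∨ z = b ∧ k = j - m)

/-- A run of kept letters has exponent 0 < |j| ≤ n < m, so neither j nor j ± m vanishes. -/
theorem LeadingPower.ne_zero {a b : X} {m n : ℕ} {s : Option X × Bool} {x : X} {k : ℤ}
    (h : LeadingPower a b m n s x k) (hn : n < m) : k ≠ 0 := by
  obtain ⟨_ | z, _ | _⟩ := s
  · obtain ⟨-, rfl⟩ := h; omega
  · obtain ⟨-, rfl⟩ := h; omega
  all_goals
    obtain ⟨-, j, h1, h2, h3⟩ := h
    rw [abs_le] at h2
    simp only [Bool.false_eq_true, if_false, if_true] at h1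
    omega

theorem leadingPower_letter (a b : X) (m n : ℕ) (z : X) (t : Bool) :
    LeadingPower a b m (n + 1) (some z, t) z (if t then 1 else -1) := by
  refine ⟨rfl, if t then 1 else -1, ?_, ?_, Or.inl rfl⟩
  · cases t <;> simp
  · cases t <;> simp

theorem mk_replicate (x : X) (s : Bool) (n : ℕ) :
    FreeGroup.mk (List.replicate n (x, s)) = (FreeGroup.of x ^ (if s then (n : ℤ) else -n)) := by
  induction n with
  | zero => simp [FreeGroup.one_eq_mk]
  | succ n ih =>
    have h : FreeGroup.mk (List.replicate (n + 1) (x, s))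
        = FreeGroup.mk [(x, s)] * FreeGroup.mk (List.replicate n (x, s)) := by
      rw [FreeGroup.mul_mk]; rfl
    rw [h, ih]
    cases s
    · have : FreeGroup.mk [(x, false)] = (FreeGroup.of x)⁻¹ := rfl
      rw [this]
      simp only [Bool.false_eq_true, if_false]
      push_cast
      rw [← zpow_neg_one, ← zpow_add]; congr 1; ring
    · have : FreeGroup.mk [(x, true)] = FreeGroup.of x := rfl
      rw [this]
      simp only [if_true]
      push_cast
      rw [← zpow_one_add]; congr 1; ring

variable [DecidableEq X]

/-- The reduced word of `g` does not start with `x` or its inverse. -/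
def NotHead (x : X) (g : FreeGroup X) : Prop := ∀ p ∈ g.toWord.head?, p.1 ≠ x

theorem notHead_one (x : X) : NotHead x 1 := by simp [NotHead]

theorem NotHead.toWord_zpow_mul {x : X} {g : FreeGroup X} (h : NotHead x g) {k : ℤ} (hk : k ≠ 0) :
    ∃ (s : Bool) (n : ℕ),
      (FreeGroup.of x ^ k * g).toWord = List.replicate (n + 1) (x, s) ++ g.toWord := by
  obtain ⟨n, s, rfl⟩ : ∃ (n : ℕ) (s : Bool), k = if s then ((n + 1 : ℕ) : ℤ) else -(n + 1 : ℕ) := by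
    rcases lt_or_gt_of_ne hk with hk | hk
    · exact ⟨(-k - 1).toNat, false, by simp only [Bool.false_eq_true, if_false]; omega⟩
    · exact ⟨(k - 1).toNat, true, by simp only [if_true]; omega⟩
  refine ⟨s, n, ?_⟩
  rw [← mk_replicate]
  conv_lhs => rw [← FreeGroup.mk_toWord (x := g)]
  rw [FreeGroup.mul_mk, FreeGroup.toWord_mk]
  refine FreeGroup.IsReduced.reduce_eq ?_
  refine List.isChain_append.2 ⟨List.isChain_replicate_of_rel _ fun _ => rfl,
    FreeGroup.isReduced_toWord, ?_⟩
  intro p hp q hq e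
  have hp' := List.eq_of_mem_replicate (List.mem_of_mem_getLast? hp)
  subst hp'
  exact absurd e.symm (h q hq)

theorem NotHead.zpow_mul {x z : X} {g : FreeGroup X} (h : NotHead x g) {k : ℤ} (hk : k ≠ 0)
    (hz : x ≠ z) : NotHead z (FreeGroup.of x ^ k * g) := by
  obtain ⟨s, n, e⟩ := h.toWord_zpow_mul hk
  intro p hp
  rw [e, List.replicate_succ] at hp
  simp only [List.cons_append, List.head?_cons, Option.mem_def, Option.some.injEq] at hp
  subst hp; exact hz

theorem NotHead.zpow_mul_ne_one {x : X} {g : FreeGroup X} (h : NotHead x g) {k : ℤ} (hk : k ≠ 0) :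
    FreeGroup.of x ^ k * g ≠ 1 := by
  obtain ⟨s, n, e⟩ := h.toWord_zpow_mul hk
  intro h1
  rw [h1] at e
  simp [List.replicate_succ] at e

/-- Letters are added on the left while the maximal leading power is recorded. Powers merge only
when a run of a meets a block aᵐbᵐ, when a run of b meets b⁻ᵐa⁻ᵐ, or when the right end bᵐ or a⁻ᵐ of
a new block meets a power of the same letter. Runs are shorter than m, so an m-th power survives
them. Writing y for the letter `none`, in y bʲ y⁻¹ the two m-th powers do cancel, but bʲ with j ≠ 0
remains. -/
theorem exists_leadingPower {a b : X} (hab : a ≠ b) {m : ℕ} (L : List (Option X × Bool))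
    (s : Option X × Bool) (hr : FreeGroup.IsReduced (s :: L)) (hm : L.length + 1 < m) :
    ∃ x k g, LeadingPower a b m (L.length + 1) s x k ∧ NotHead x g ∧
      evalWord (substLetter a b m) (s :: L) = FreeGroup.of x ^ k * g := by
  induction L generalizing s with
  | nil =>
    have hm0 : (m : ℤ) ≠ 0 := by omega
    obtain ⟨_ | z, _ | _⟩ := s
    · refine ⟨b, -m, FreeGroup.of a ^ (-m : ℤ) * 1, ⟨rfl, rfl⟩,
        (notHead_one a).zpow_mul (by omega) hab, ?_⟩
      rw [evalWord_cons_false, evalWord_nil]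
      simp [substLetter]
    · refine ⟨a, m, FreeGroup.of b ^ (m : ℤ) * 1, ⟨rfl, rfl⟩,
        (notHead_one b).zpow_mul hm0 hab.symm, ?_⟩
      rw [evalWord_cons_true, evalWord_nil]
      simp [substLetter]
    · refine ⟨z, -1, 1, leadingPower_letter a b m 0 z false, notHead_one z, ?_⟩
      rw [evalWord_cons_false, evalWord_nil]
      simp [substLetter]
    · refine ⟨z, 1, 1, leadingPower_letter a b m 0 z true, notHead_one z, ?_⟩
      rw [evalWord_cons_true, evalWord_nil]
      simp [substLetter]
  | cons s' L ih =>
    simp only [List.length_cons] at hm ⊢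
    rw [FreeGroup.isReduced_cons_cons] at hr
    obtain ⟨x, k, g, hlead, hg, he⟩ := ih s' hr.2 (by omega)
    have hk0 : k ≠ 0 := hlead.ne_zero (by omega)
    have hm0 : (m : ℤ) ≠ 0 := by omega
    obtain ⟨_ | z, t⟩ := s
    · -- the substituted letter
      cases t
      · rw [evalWord_cons_false, he]
        obtain ⟨k', g', hg', e', hk'⟩ : ∃ (k' : ℤ) (g' : FreeGroup X), NotHead a g' ∧
            FreeGroup.of a ^ (-m : ℤ) * (FreeGroup.of x ^ k * g) = FreeGroup.of a ^ k' * g' ∧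
            k' ≠ 0 := by
          by_cases hx : x = a
          · subst hx
            refine ⟨-m + k, g, hg, by rw [← mul_assoc, ← zpow_add], ?_⟩
            -- The value k = m could only come from the inverse of the new letter, which reducedness
            -- excludes. Otherwise k is j or m + j with 0 < |j| < m.
            obtain ⟨_ | z, _ | _⟩ := s'
            · exact absurd hlead.1 hab
            · exact absurd (hr.1 rfl) (by simp)
            all_goals
              obtain ⟨rfl, j, h1, h2, h3⟩ := hlead
              rw [abs_le] at h2
              simp only [Bool.false_eq_true, if_false, if_true] at h1
              simp only [hab, false_and, or_false, true_and] at h3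
              omega
          · exact ⟨-m, _, hg.zpow_mul hk0 hx, rfl, by omega⟩
        refine ⟨b, -m, FreeGroup.of a ^ k' * g', ⟨rfl, rfl⟩, hg'.zpow_mul hk' hab, ?_⟩
        rw [← e']
        simp [substLetter, mul_assoc]
      · rw [evalWord_cons_true, he]
        obtain ⟨k', g', hg', e', hk'⟩ : ∃ (k' : ℤ) (g' : FreeGroup X), NotHead b g' ∧
            FreeGroup.of b ^ (m : ℤ) * (FreeGroup.of x ^ k * g) = FreeGroup.of b ^ k' * g' ∧
            k' ≠ 0 := by
          by_cases hx : x = b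
          · subst hx
            refine ⟨m + k, g, hg, by rw [← mul_assoc, ← zpow_add], ?_⟩
            obtain ⟨_ | z, _ | _⟩ := s'
            · exact absurd (hr.1 rfl) (by simp)
            · exact absurd hlead.1.symm hab
            all_goals
              obtain ⟨rfl, j, h1, h2, h3⟩ := hlead
              rw [abs_le] at h2
              simp only [Bool.false_eq_true, if_false, if_true] at h1
              simp only [hab.symm, false_and, false_or, true_and] at h3
              omega
          · exact ⟨m, _, hg.zpow_mul hk0 hx, rfl, hm0⟩
        refine ⟨a, m, FreeGroup.of b ^ k' * g', ⟨rfl, rfl⟩, hg'.zpow_mul hk' hab.symm, ?_⟩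
        rw [← e']
        simp [substLetter, mul_assoc]
    · -- a letter that is kept
      have hev : evalWord (substLetter a b m) ((some z, t) :: s' :: L)
          = FreeGroup.of z ^ (if t then (1 : ℤ) else -1) * (FreeGroup.of x ^ k * g) := by
        cases t
        · rw [evalWord_cons_false, he]; simp [substLetter]
        · rw [evalWord_cons_true, he]; simp [substLetter]
      rw [hev]
      by_cases hx : x = z
      · subst hx
        refine ⟨x, (if t then (1 : ℤ) else -1) + k, g, ⟨rfl, ?_⟩, hg,
          by rw [← mul_assoc, ← zpow_add]⟩
        obtain ⟨_ | z', t'⟩ := s'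
        · refine ⟨if t then 1 else -1, by cases t <;> simp, by cases t <;> simp <;> omega, ?_⟩
          cases t'
          · obtain ⟨rfl, rfl⟩ := hlead
            exact .inr (.inr ⟨rfl, by ring⟩)
          · obtain ⟨rfl, rfl⟩ := hlead
            exact .inr (.inl ⟨rfl, by ring⟩)
        · obtain ⟨rfl, j, h1, h2, h3⟩ := hlead
          obtain rfl : t = t' := hr.1 rfl
          refine ⟨(if t then (1 : ℤ) else -1) + j, ?_, ?_, ?_⟩
          · cases t <;> simp only [Bool.false_eq_true, if_false, if_true] at h1 ⊢ <;> omega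
          · rw [abs_le] at h2 ⊢
            cases t <;> simp only [Bool.false_eq_true, if_false, if_true] at h1 ⊢ <;>
              push_cast at h2 ⊢ <;> omega
          · rcases h3 with h3 | ⟨h, h3⟩ | ⟨h, h3⟩
            · exact .inl (by rw [h3])
            · exact .inr (.inl ⟨h, by rw [h3]; ring⟩)
            · exact .inr (.inr ⟨h, by rw [h3]; ring⟩)
      · exact ⟨z, if t then 1 else -1, _, leadingPower_letter a b m _ z t,
          hg.zpow_mul hk0 hx, rfl⟩

/-- Short nontrivial words stay nontrivial under the substitution. -/
theorem evalWord_substLetter_ne_one {a b : X} (hab : a ≠ b) {m : ℕ} {L : List (Option X × Bool)}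
    (hr : FreeGroup.IsReduced L) (h0 : L ≠ []) (hm : L.length < m) :
    evalWord (substLetter a b m) L ≠ 1 := by
  obtain ⟨s, L, rfl⟩ := List.exists_cons_of_ne_nil h0
  obtain ⟨x, k, g, hl, hg, he⟩ := exists_leadingPower hab L s hr hm
  rw [he]
  exact hg.zpow_mul_ne_one (hl.ne_zero hm)

theorem norm_evalWord_substLetter_le (a b : X) {m : ℕ} (hm : 1 ≤ m) (L : List (Option X × Bool)) :
    (evalWord (substLetter a b m) L).norm ≤ 2 * m * L.length := by
  have hl : ∀ o : Option X, (substLetter a b m o).norm ≤ 2 * m := by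
    rintro (_ | z)
    · refine (FreeGroup.norm_mul_le _ _).trans ?_
      rw [FreeGroup.norm_of_pow, FreeGroup.norm_of_pow]; omega
    · change (FreeGroup.of z).norm ≤ _
      rw [FreeGroup.norm_of]; omega
  induction L with
  | nil => rw [evalWord_nil]; simp
  | cons s L ih =>
    obtain ⟨o, _ | _⟩ := s
    · rw [evalWord_cons_false, List.length_cons]
      refine (FreeGroup.norm_mul_le _ _).trans ?_
      rw [FreeGroup.norm_inv_eq]
      linarith [hl o]
    · rw [evalWord_cons_true, List.length_cons]
      refine (FreeGroup.norm_mul_le _ _).trans ?_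
      linarith [hl o]

end Substitution

/-! ### Orbits near `0` -/

/-- `h` multiplies the coordinate of points by at most `c`, as soon as it is at least `ε`. -/
def Grows (ε : ℝ) (h : thompsonF) (c : ℝ) : Prop :=
  ∀ B : ℝ, ε ≤ B → ∀ t : unitInterval, (t : ℝ) < B → (h.1 t : ℝ) < c * B

section Grows

variable {ε : ℝ}

/-- Since c' ≥ 1, the intermediate bound c' B is again at least ε; this is why `Grows` quantifies
over all B ≥ ε. -/
theorem Grows.mul {h h' : thompsonF} {c c' : ℝ} (hε : 0 < ε) (hc : 1 ≤ c') (H : Grows ε h c)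
    (H' : Grows ε h' c') : Grows ε (h * h') (c * c') := by
  intro B hB t ht
  have := H (c' * B) (by nlinarith) _ (H' B hB t ht)
  rwa [mul_assoc]

theorem Grows.mono {h : thompsonF} {c c' : ℝ} (hε : 0 < ε) (H : Grows ε h c) (hc : c ≤ c') :
    Grows ε h c' :=
  fun B hB t ht => (H B hB t ht).trans_le (by gcongr; linarith)

theorem grows_one : Grows ε 1 1 := fun B _ t ht => by
  rw [one_mul]; exact ht

theorem Grows.pow {h : thompsonF} {c : ℝ} (hε : 0 < ε) (hc : 1 ≤ c) (H : Grows ε h c) (n : ℕ) :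
    Grows ε (h ^ n) (c ^ n) := by
  induction n with
  | zero => simpa using grows_one
  | succ n ih =>
    rw [pow_succ, pow_succ]
    exact ih.mul hε hc H

theorem x0_apply_le (t : unitInterval) : (x0.1 t : ℝ) ≤ t := by
  have := t.2.1
  have := t.2.2
  rw [x0_apply]; unfold x0Fun; split_ifs <;> linarith

theorem grows_x0 : Grows ε x0 1 := fun B _ t ht => by
  rw [one_mul]; exact (x0_apply_le t).trans_lt ht

theorem grows_x0_inv : Grows ε x0⁻¹ 2 := fun B _ t ht => by
  have := t.2.1
  rw [x0_inv_apply]; unfold x0Inv; split_ifs <;> linarith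

/-- A moved point stays in the support, hence below ε ≤ B. -/
theorem grows_of_supportF {f : thompsonF} (hf : supportF f ⊆ {t | (t : ℝ) < ε}) :
    Grows ε f 1 := by
  intro B hB t ht
  rw [one_mul]
  by_cases h : f.1 t = t
  · rw [h]; exact ht
  · have : f.1 t ∈ supportF f := subset_closure fun h' => h (f.1.injective h')
    exact lt_of_lt_of_le (hf this) hB

theorem grows_inv_of_supportF {f : thompsonF} (hf : supportF f ⊆ {t | (t : ℝ) < ε}) :
    Grows ε f⁻¹ 1 := by
  intro B hB t ht
  rw [one_mul]
  by_cases h : (f⁻¹ : thompsonF).1 t = t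
  · rw [h]; exact ht
  · have e : f.1 ((f⁻¹ : thompsonF).1 t) = t := f.1.apply_symm_apply t
    have : (f⁻¹ : thompsonF).1 t ∈ supportF f := subset_closure fun h' => h (h'.symm.trans e)
    exact lt_of_lt_of_le (hf this) hB

theorem apply_eq_of_supportF {f : thompsonF} (hf : supportF f ⊆ {t | (t : ℝ) < ε})
    {t : unitInterval} (ht : ε ≤ t) : f.1 t = t := by
  by_contra h
  have : t ∈ supportF f := subset_closure h
  exact absurd (hf this) (not_lt.2 ht)

end Grows

/-! ### The generating sets and their short words -/

section Generators

variable {ι : Type*}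

/-- The letters `x₀` and `uᵢ`. -/
noncomputable def baseGen (u : ι → thompsonF) (o : Option ι) : thompsonF := o.elim x0 u

/-- The generating set `x₀`, `uᵢ` and `x₀ᵐ uᵐ x₁` as a family. -/
noncomputable def fullGen (u : ι → thompsonF) (i₀ : ι) (m : ℕ) (o : Option (Option ι)) :
    thompsonF :=
  o.elim (x0 ^ m * u i₀ ^ m * x1) (baseGen u)

variable {u : ι → thompsonF} {ε : ℝ}

theorem x1_apply_of_le {t : unitInterval} (ht : (t : ℝ) ≤ 1 / 2) : x1.1 t = t := by
  refine Subtype.ext ?_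
  rw [x1_apply]; unfold x1Fun; rw [if_pos ht]

theorem x1_inv_apply_of_le {t : unitInterval} (ht : (t : ℝ) ≤ 1 / 2) :
    (x1⁻¹ : thompsonF).1 t = t := by
  refine Subtype.ext ?_
  rw [x1_inv_apply]; unfold x1Inv; rw [if_pos ht]

theorem lift_substLetter_none (i₀ : ι) (m : ℕ) :
    FreeGroup.lift (baseGen u) (substLetter none (some i₀) m none) = x0 ^ m * u i₀ ^ m := by
  simp [substLetter, baseGen]

theorem lift_substLetter_some (i₀ : ι) (m : ℕ) (o : Option ι) :
    FreeGroup.lift (baseGen u) (substLetter none (some i₀) m (some o)) = baseGen u o := by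
  simp [substLetter]

/-- Among x₀, the uᵢ and their inverses only x₀⁻¹ expands, by a factor 2, and (x₀ᵐ uᵐ)⁻¹ contains it
m times. -/
theorem grows_substLetter (hε : 0 < ε) (hu : ∀ i, supportF (u i) ⊆ {t | (t : ℝ) < ε}) (i₀ : ι)
    {m : ℕ} (hm : 1 ≤ m) (o : Option (Option ι)) :
    Grows ε (FreeGroup.lift (baseGen u) (substLetter none (some i₀) m o)) (2 ^ m) ∧
    Grows ε (FreeGroup.lift (baseGen u) (substLetter none (some i₀) m o))⁻¹ (2 ^ m) := by
  have h1 : (1 : ℝ) ≤ 2 ^ m := one_le_pow₀ one_le_two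
  have h2 : (2 : ℝ) ≤ 2 ^ m := le_self_pow₀ one_le_two (by omega)
  obtain _ | _ | i := o
  · rw [lift_substLetter_none]
    constructor
    · refine Grows.mono hε (c := 1 ^ m * 1 ^ m) ?_ (by simpa using h1)
      exact (grows_x0.pow hε le_rfl m).mul hε (by simp)
        ((grows_of_supportF (hu i₀)).pow hε le_rfl m)
    · rw [mul_inv_rev, ← inv_pow, ← inv_pow]
      refine Grows.mono hε (c := 1 ^ m * 2 ^ m) ?_ (by simp)
      exact ((grows_inv_of_supportF (hu i₀)).pow hε le_rfl m).mul hε h1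
        (grows_x0_inv.pow hε one_le_two m)
  · rw [lift_substLetter_some]
    exact ⟨grows_x0.mono hε h1, grows_x0_inv.mono hε h2⟩
  · rw [lift_substLetter_some]
    exact ⟨(grows_of_supportF (hu i)).mono hε h1, (grows_inv_of_supportF (hu i)).mono hε h1⟩

/-- On points near `0`, the factor `x₁` of the generators plays no role in short words. -/
theorem evalWord_fullGen_apply (hε : 0 < ε) (hu : ∀ i, supportF (u i) ⊆ {t | (t : ℝ) < ε})
    (i₀ : ι) {m : ℕ} (hm : 1 ≤ m) {t : unitInterval} (ht : (t : ℝ) < ε)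
    (L : List (Option (Option ι) × Bool)) (hL : (2 : ℝ) ^ (m * L.length) * ε ≤ 1 / 2) :
    (evalWord (fullGen u i₀ m) L).1 t =
      (FreeGroup.lift (baseGen u) (evalWord (substLetter none (some i₀) m) L)).1 t ∧
    ((evalWord (fullGen u i₀ m) L).1 t : ℝ) < 2 ^ (m * L.length) * ε := by
  induction L with
  | nil =>
    rw [evalWord_nil, evalWord_nil, map_one]
    exact ⟨rfl, by simpa using ht⟩
  | cons s L ih =>
    have e : (2 : ℝ) ^ (m * (s :: L).length) * ε = 2 ^ m * (2 ^ (m * L.length) * ε) := by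
      rw [List.length_cons, Nat.mul_succ, pow_add]; ring
    have h1 : (1 : ℝ) ≤ 2 ^ m := one_le_pow₀ one_le_two
    have h1' : (1 : ℝ) ≤ 2 ^ (m * L.length) := one_le_pow₀ one_le_two
    have hpos : 0 < (2 : ℝ) ^ (m * L.length) * ε := by positivity
    have hle : (2 : ℝ) ^ (m * L.length) * ε ≤ 1 / 2 := by
      rw [e] at hL; nlinarith
    have hεle : ε ≤ (2 : ℝ) ^ (m * L.length) * ε := by nlinarith
    obtain ⟨i1, i2⟩ := ih hle
    rw [e] at hL ⊢
    obtain ⟨o, _ | _⟩ := s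
    · rw [evalWord_cons_false, evalWord_cons_false, map_mul, map_inv]
      set v := FreeGroup.lift (baseGen u) (substLetter none (some i₀) m o) with hv
      have hg := (grows_substLetter hε hu i₀ hm o).2 _ hεle _ i2
      have hgen : (fullGen u i₀ m o)⁻¹.1 ((evalWord (fullGen u i₀ m) L).1 t)
          = v⁻¹.1 ((evalWord (fullGen u i₀ m) L).1 t) := by
        cases o with
        | none =>
          -- Here x₁⁻¹ acts last, so the point must lie below 1/2 after the step; for the generator
          -- itself x₁ acts first and the bound before the step suffices.
          have : (fullGen u i₀ m none)⁻¹ = x1⁻¹ * v⁻¹ := by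
            rw [hv, lift_substLetter_none, ← mul_inv_rev]; rfl
          rw [this]
          exact x1_inv_apply_of_le (hg.le.trans hL)
        | some o => rw [hv, lift_substLetter_some]; rfl
      constructor
      · change (fullGen u i₀ m o)⁻¹.1 ((evalWord (fullGen u i₀ m) L).1 t) = v⁻¹.1 _
        rw [hgen, i1]; rfl
      · change (((fullGen u i₀ m o)⁻¹.1 ((evalWord (fullGen u i₀ m) L).1 t) : unitInterval) : ℝ) < _
        rw [hgen]; exact hg
    · rw [evalWord_cons_true, evalWord_cons_true, map_mul]
      set v := FreeGroup.lift (baseGen u) (substLetter none (some i₀) m o) with hv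
      have hg := (grows_substLetter hε hu i₀ hm o).1 _ hεle _ i2
      have hgen : (fullGen u i₀ m o).1 ((evalWord (fullGen u i₀ m) L).1 t)
          = v.1 ((evalWord (fullGen u i₀ m) L).1 t) := by
        cases o with
        | none =>
          have : fullGen u i₀ m none = v * x1 := by
            rw [hv, lift_substLetter_none]; rfl
          rw [this]
          change v.1 (x1.1 _) = _
          rw [x1_apply_of_le (i2.le.trans hle)]
        | some o => rw [hv, lift_substLetter_some]; rfl
      constructor
      · change (fullGen u i₀ m o).1 ((evalWord (fullGen u i₀ m) L).1 t) = v.1 _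
        rw [hgen, i1]; rfl
      · change (((fullGen u i₀ m o).1 ((evalWord (fullGen u i₀ m) L).1 t) : unitInterval) : ℝ) < _
        rw [hgen]; exact hg

theorem x0_pow_apply_le (n : ℕ) (t : unitInterval) : ((x0 ^ n).1 t : ℝ) ≤ t := by
  induction n generalizing t with
  | zero => exact le_rfl
  | succ n ih =>
    rw [pow_succ]
    exact (ih (x0.1 t)).trans (x0_apply_le t)

theorem pow_apply_eq_self {f : thompsonF} {t : unitInterval} (h : f.1 t = t) (n : ℕ) :
    (f ^ n).1 t = t := by
  induction n with
  | zero => rfl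
  | succ n ih =>
    rw [pow_succ]
    change (f ^ n).1 (f.1 t) = t
    rw [h, ih]

/-- The point 3/4 separates them: x₀ sends it to 1/2, the uᵢ fix it, and x₀ᵐ uᵐ x₁ sends it to 5/8
for m = 0 and to at most 3/8 for m > 0. -/
theorem fullGen_none_ne (hε : ε < 1 / 2) (hu : ∀ i, supportF (u i) ⊆ {t | (t : ℝ) < ε})
    (i₀ : ι) (m : ℕ) (o : Option ι) : fullGen u i₀ m none ≠ baseGen u o := by
  intro h
  set p : unitInterval := ⟨3 / 4, by norm_num, by norm_num⟩ with hp
  have hp' : (p : ℝ) = 3 / 4 := rfl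
  have h1 : (x1.1 p : ℝ) = 5 / 8 := by
    rw [x1_apply, hp']; unfold x1Fun; norm_num
  have h2 : (u i₀ ^ m).1 (x1.1 p) = x1.1 p :=
    pow_apply_eq_self (apply_eq_of_supportF (hu i₀) (by rw [h1]; linarith)) m
  have h3 : (fullGen u i₀ m none).1 p = (x0 ^ m).1 (x1.1 p) := by
    change (x0 ^ m).1 ((u i₀ ^ m).1 (x1.1 p)) = _
    rw [h2]
  have h4 : ((fullGen u i₀ m none).1 p : ℝ) = 5 / 8 ∨
      ((fullGen u i₀ m none).1 p : ℝ) ≤ 3 / 8 := by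
    rw [h3]
    cases m with
    | zero => exact .inl h1
    | succ n =>
      right
      rw [pow_succ]
      refine (x0_pow_apply_le n (x0.1 (x1.1 p))).trans ?_
      rw [x0_apply, h1]; unfold x0Fun; norm_num
  rw [h] at h4
  cases o with
  | none =>
    have h5 : ((baseGen u none).1 p : ℝ) = 1 / 2 := by
      change (x0.1 p : ℝ) = _
      rw [x0_apply, hp']; unfold x0Fun; norm_num
    rw [h5] at h4
    norm_num at h4
  | some i =>
    have h5 : (baseGen u (some i)).1 p = p :=
      apply_eq_of_supportF (hu i) (by rw [hp']; linarith)
    rw [h5, hp'] at h4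
    norm_num at h4

theorem closure_range_fullGen (i₀ : ι) (m : ℕ) :
    Subgroup.closure (Set.range (fullGen u i₀ m)) = ⊤ := by
  have hm : ∀ o, fullGen u i₀ m o ∈ Subgroup.closure (Set.range (fullGen u i₀ m)) :=
    fun o => Subgroup.subset_closure ⟨o, rfl⟩
  have h0 : x0 ∈ Subgroup.closure (Set.range (fullGen u i₀ m)) := hm (some none)
  have hi : u i₀ ∈ Subgroup.closure (Set.range (fullGen u i₀ m)) := hm (some (some i₀))
  have hy : x0 ^ m * u i₀ ^ m * x1 ∈ Subgroup.closure (Set.range (fullGen u i₀ m)) := hm none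
  have h1 : x1 ∈ Subgroup.closure (Set.range (fullGen u i₀ m)) := by
    have := mul_mem (inv_mem (mul_mem (pow_mem h0 m) (pow_mem hi m))) hy
    rwa [inv_mul_cancel_left] at this
  rw [eq_top_iff, ← closure_x0_x1, Subgroup.closure_le]
  rintro f (rfl | rfl)
  · exact h0
  · exact h1

theorem range_fullGen (i₀ : ι) (m : ℕ) :
    Set.range (fullGen u i₀ m) = {x0, x0 ^ m * u i₀ ^ m * x1} ∪ Set.range u := by
  ext f
  constructor
  · rintro ⟨_ | _ | i, rfl⟩
    · exact .inl (.inr rfl)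
    · exact .inl (.inl rfl)
    · exact .inr ⟨i, rfl⟩
  · rintro ((rfl | rfl) | ⟨i, rfl⟩)
    · exact ⟨some none, rfl⟩
    · exact ⟨none, rfl⟩
    · exact ⟨some (some i), rfl⟩

end Generators

/-! ### Lower bounds for the girth and the theorem -/

theorem norm_map_le {α β : Type*} [DecidableEq α] [DecidableEq β] (f : α → β) (w : FreeGroup α) :
    (FreeGroup.map f w).norm ≤ w.norm := by
  conv_lhs => rw [← FreeGroup.mk_toWord (x := w), FreeGroup.map.mk]
  refine FreeGroup.norm_mk_le.trans ?_
  rw [List.length_map]; rfl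

/-- A lower bound for the girth with respect to the range of a family of elements. -/
theorem le_girth_range {α G : Type*} [DecidableEq α] [Group G] (g : α → G) (n : ℕ)
    (h : ∀ w : FreeGroup α, w ≠ 1 → w.norm < n → FreeGroup.lift g w ≠ 1) :
    (n : ℕ∞) ≤ girth (Set.range g) := by
  classical
  refine le_iInf fun w => le_iInf fun hw => le_iInf fun hlift => ?_
  -- Choosing an index for each element carries a relator in the range injectively to a relator in
  -- the indices that is no longer.
  choose c hc using fun s : Set.range g => s.2
  have hinj : Function.Injective c := fun s s' e => Subtype.ext (by rw [← hc s, ← hc s', e])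
  have e : FreeGroup.lift g (FreeGroup.map c w) = 1 := by
    rw [← hlift]
    have : (FreeGroup.lift g).comp (FreeGroup.map c)
        = FreeGroup.lift (Subtype.val : Set.range g → G) := by
      ext s; simp [hc]
    exact DFunLike.congr_fun this w
  by_contra hn
  rw [not_le, Nat.cast_lt] at hn
  refine h (FreeGroup.map c w) (fun h1 => hw ?_) ((norm_map_le c w).trans_lt hn) e
  exact FreeGroup.map_injective hinj (h1.trans (map_one _).symm)

section Final

variable {ι : Type*} [DecidableEq ι] {u : ι → thompsonF} {ε : ℝ} {m : ℕ}

/-- After substitution, a relator of length < m would become a nontrivial word of length at most 2m²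
in x₀ and the uᵢ that fixes all points below ε, against `hrel`. -/
theorem le_girth_range_fullGen (hε : 0 < ε) (hε' : 2 ^ (m ^ 2) * ε < 1 / 2)
    (hu : ∀ i, supportF (u i) ⊆ {t | (t : ℝ) < ε})
    (hrel : ∀ w : FreeGroup (Option ι), w ≠ 1 → w.norm ≤ 2 * m ^ 2 →
      ∃ t : unitInterval, 0 < (t : ℝ) ∧ (t : ℝ) < ε ∧ (FreeGroup.lift (baseGen u) w).1 t ≠ t)
    (i₀ : ι) : (m : ℕ∞) ≤ girth (Set.range (fullGen u i₀ m)) := by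
  refine le_girth_range _ _ fun w hw hwm h => ?_
  have hm : 1 ≤ m := by omega
  have hlen : w.toWord.length < m := hwm
  have hne : evalWord (substLetter none (some i₀) m) w.toWord ≠ 1 :=
    evalWord_substLetter_ne_one (by simp) FreeGroup.isReduced_toWord
      (fun h0 => hw (FreeGroup.toWord_eq_nil_iff.1 h0)) hlen
  obtain ⟨t, -, ht, hmv⟩ := hrel _ hne (by
    refine (norm_evalWord_substLetter_le _ _ hm _).trans ?_
    rw [sq, mul_assoc]
    gcongr)
  refine hmv ?_
  rw [← (evalWord_fullGen_apply hε hu i₀ hm ht w.toWord ?_).1, evalWord, FreeGroup.mk_toWord, h]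
  · rfl
  · refine le_trans ?_ hε'.le
    gcongr
    · exact one_le_two
    · rw [sq]; gcongr

theorem injective_fullGen (hε : ε < 1 / 2) (hu : ∀ i, supportF (u i) ⊆ {t | (t : ℝ) < ε})
    (hrel : ∀ w : FreeGroup (Option ι), w ≠ 1 → w.norm ≤ 2 → FreeGroup.lift (baseGen u) w ≠ 1)
    (i₀ : ι) : Function.Injective (fullGen u i₀ m) := by
  have hbase : Function.Injective (baseGen u) := by
    intro o o' h
    by_contra hne
    refine hrel (FreeGroup.of o * (FreeGroup.of o')⁻¹) (fun h1 => hne ?_) ?_ ?_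
    · exact FreeGroup.of_injective (mul_inv_eq_one.1 h1)
    · refine (FreeGroup.norm_mul_le _ _).trans ?_
      rw [FreeGroup.norm_inv_eq, FreeGroup.norm_of, FreeGroup.norm_of]
    · simp [h]
  rintro (_ | o) (_ | o') h
  · rfl
  · exact absurd h (fullGen_none_ne hε hu i₀ m o')
  · exact absurd h.symm (fullGen_none_ne hε hu i₀ m o)
  · exact congrArg some (hbase h)

end Final

theorem exists_generating_sets (l : ℕ) (hl : 0 < l - 2) (ε : ℕ → ℝ)
    (hε : ∀ m, 0 < ε m ∧ 2 ^ (m ^ 2) * ε m < 1 / 2) :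
    ∃ (u : ℕ → Fin (l - 2) → thompsonF) (S : ℕ → Set thompsonF),
      (∀ m, S m = {x0, x0 ^ m * u m ⟨0, hl⟩ ^ m * x1} ∪ Set.range (u m)) ∧
      (∀ m, (S m).ncard = l ∧ Subgroup.closure (S m) = ⊤) ∧
      (∀ m i, supportF (u m i) ⊆ {t | (t : ℝ) < ε m}) ∧
      (∀ m, ∀ w : FreeGroup (Option (Fin (l - 2))), w ≠ 1 → w.norm ≤ 2 * m ^ 2 →
        ∃ t : unitInterval, 0 < (t : ℝ) ∧ (t : ℝ) < ε m ∧
          (FreeGroup.lift (fun o : Option (Fin (l - 2)) => o.elim x0 (u m)) w).1 t ≠ t) ∧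
      Tendsto (fun m => girth (S m)) atTop (𝓝 ⊤) := by
  -- The extra 2 covers the words uᵢ uⱼ⁻¹ and x₀ uᵢ⁻¹ even for m = 0, so that the generators are
  -- distinct.
  choose u hu hrel using fun m =>
    exists_no_short_relation (ι := Fin (l - 2)) (2 * m ^ 2 + 2) (hε m).1
  have hhalf : ∀ m, ε m < 1 / 2 := by
    intro m
    have h1 : (1 : ℝ) ≤ 2 ^ (m ^ 2) := one_le_pow₀ one_le_two
    have := (hε m).1
    nlinarith [(hε m).2]
  refine ⟨u, fun m => Set.range (fullGen (u m) ⟨0, hl⟩ m), fun m => range_fullGen _ m,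
    fun m => ⟨?_, closure_range_fullGen _ m⟩, hu,
    fun m w hw hn => hrel m w hw (by omega), ?_⟩
  · have hinj : Function.Injective (fullGen (u m) ⟨0, hl⟩ m) := by
      refine injective_fullGen (hhalf m) (hu m) (fun w hw hn h => ?_) _
      obtain ⟨t, -, -, ht⟩ := hrel m w hw (by omega)
      refine ht ?_
      change (FreeGroup.lift (baseGen (u m)) w).1 t = t
      rw [h]; rfl
    rw [← Nat.card_coe_set_eq, Nat.card_range_of_injective hinj]
    simp only [Nat.card_eq_fintype_card, Fintype.card_option, Fintype.card_fin]
    omega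
  · refine tendsto_nhds_top_mono (f := fun m : ℕ => (m : ℕ∞)) ?_ (Eventually.of_forall fun m => ?_)
    · exact ENat.tendsto_natCast_nhds_top
    · exact le_girth_range_fullGen (hε m).1 (hε m).2 (hu m)
        (fun w hw hn => hrel m w hw (by omega)) _

theorem groupGirth_thompsonF : groupGirth thompsonF = ⊤ := by
  obtain ⟨u, S, -, hS, -, -, hlim⟩ := exists_generating_sets 3 one_pos
    (fun m => 1 / 4 / 2 ^ (m ^ 2)) fun m => ⟨by positivity, by field_simp; norm_num⟩
  refine top_le_iff.1 (le_of_tendsto hlim (Eventually.of_forall fun m => ?_))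
  -- Infinite sets have `ncard` 0, so the value 3 gives finiteness.
  have hfin : (S m).Finite := Set.finite_of_ncard_ne_zero (by rw [(hS m).1]; norm_num)
  have := le_iSup₂ (f := fun (T : Finset thompsonF)
    (_ : Subgroup.closure (T : Set thompsonF) = ⊤) => girth (T : Set thompsonF)) hfin.toFinset
    (by rw [hfin.coe_toFinset]; exact (hS m).2)
  rwa [hfin.coe_toFinset] at this

theorem theorem3p5 :
    groupGirth thompsonF = ⊤ ∧
    ∀ (l : ℕ) (hl : 3 ≤ l) (ε : ℕ → ℝ), (∀ m, 0 < ε m ∧ 2 ^ (m ^ 2) * ε m < 1 / 2) →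
      ∃ (u : ℕ → Fin (l - 2) → thompsonF) (S : ℕ → Set thompsonF),
        (∀ m, S m = {x0, x0 ^ m * u m ⟨0, by omega⟩ ^ m * x1} ∪ Set.range (u m)) ∧
        (∀ m, (S m).ncard = l ∧ Subgroup.closure (S m) = ⊤) ∧
        (∀ m i, supportF (u m i) ⊆ {t | (t : ℝ) < ε m}) ∧
        (∀ m, ∀ w : FreeGroup (Option (Fin (l - 2))), w ≠ 1 → w.norm ≤ 2 * m ^ 2 →
          ∃ t : unitInterval, 0 < (t : ℝ) ∧ (t : ℝ) < ε m ∧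
            (FreeGroup.lift (fun o : Option (Fin (l - 2)) => o.elim x0 (u m)) w).1 t ≠ t) ∧
        Tendsto (fun m => girth (S m)) atTop (𝓝 ⊤) :=
  ⟨groupGirth_thompsonF, fun l hl => exists_generating_sets l (by omega)⟩
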